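/- **Proposition 2.** Let $p\ge 0$ be a real-valued continuous function on $[0,\infty)$ with $\liminf_{t\to\infty}p(t)/t^{\alpha}>0$ for some $\alpha>0$, let $c\in\mathbf R$, and let $\{X_\omega(t)\}_{t\ge0}$ be a fractional Brownian motion of Hurst parameter $h\in(0,1)$ (a centered Gaussian process, all of whose paths are continuous and start at $0$, with $\mathbf E[X(t)X(s)]=\frac12(t^{2h}+s^{2h}-|t-s|^{2h})$). Put $a_\omega(t)=\int_t^{t+1}X_\omega(s)\,ds$, and fix any $\omega$ such that $a_\omega'(t)=O(\sqrt{\log t})$ and $X_\omega(t)-a_\omega(t)=O(\sqrt{\log t})$ as $t\to\infty$. All functions below are complex valued, and "absolutely continuous on $[0,\infty)$" means absolutely continuous on each $[0,T]$. *The operators $H_0(\omega)$ and $H_0^S(\omega)$.* Let $Q=cX_\omega$. For $u$ absolutely continuous on $[0,\infty)$ let $u^{[1]}=u'-Qu$ be its quasi-derivative. For $v\in L^1_{loc}([0,\infty))$ write $Hu=v$ if for some $\alpha\in\mathbf C$ and almost all $t\ge0$ $$u^{[1]}(t)=\alpha+\int_0^t\{p(y)u(y)-Q(y)u'(y)-v(y)\}\,dy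 ;$$ such a $v$ is unique up to null sets, and $u'$ is then taken to be continuous. Let $\mathcal D_0$ be the set of $u\in L^2(\mathbf R_+)$ with $u(0)=0$ for which $Hu$ exists and lies in $L^2(\mathbf R_+)$, and let $\mathcal D_0^S$ be the set of $u\in\mathcal D_0$ such that $[u,v](t)=u(t)v^{[1]}(t)-u^{[1]}(t)v(t)\to0$ as $t\to\infty$ for every $v\in\mathcal D_0$. Let $H_0(\omega)=H|_{\mathcal D_0}$ and $H_0^S(\omega)=H|_{\mathcal D_0^S}$, as operators in $L^2(\mathbf R_+)$. *The operator $A_\omega$.* Let $L$ be the space of $f$ absolutely continuous on $[0,\infty)$ with $f(0)=0$ and $\int_0^\infty\{|f'|^2+(1+p)|f|^2\}\,dt<\infty$, and for $u,v\in L$ let $$\mathcal E_\omega(u,v)=\int_0^\infty\{u'\overline{v'}+(p+ca_\omega')u\overline v\}\,dt-\int_0^\infty c\,(X_\omega-a_\omega)(u\overline v)'\,dt .$$ Let $A_\omega$ be the operator in $L^2(\mathbf R_+)$ associated with this form: $\psi\in D(A_\omega)$ and $A_\omega\psi=\varphi$ if and only if $\psi\in L$, $\varphi\in L^2(\mathbf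 R_+)$ and $\mathcal E_\omega(u,\psi)=(u,\varphi):=\int_0^\infty u\overline\varphi\,dt$ for all $u\in L$. Then $A_\omega$ is self-adjoint, and $$H_0^S(\omega)\subset A_\omega\subset H_0(\omega),$$ where $S\subset T$ means that the operator $T$ is an extension of $S$. -/

import Mathlib

open MeasureTheory ProbabilityTheory Set Filter Topology Asymptotics
open scoped NNReal ENNReal ComplexConjugate

noncomputable section

namespace StochasticAiry

/-- Lebesgue measure on the half-line `(0, ∞)`. -/
abbrev halfLine : Measure ℝ := volume.restrict (Ioi (0 : ℝ))

/-- The complex Hilbert space `L²(ℝ₊)`. -/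
abbrev L2 : Type := Lp ℂ 2 halfLine

/-- `u` is absolutely continuous on `[0, ∞)`, i.e. on each interval `[0, T]`. Functions on
`[0, ∞)` are represented by functions on `ℝ`, whose values on `(-∞, 0)` never matter. -/
def IsACHalfLine (u : ℝ → ℂ) : Prop :=
  ∀ T : ℝ, 0 ≤ T → AbsolutelyContinuousOnInterval u 0 T

/-! ### Generalized Sturm–Liouville operators `-d²/dt² + p + Q'` -/

/-- The quasi-derivative `u^[1] = u' - Q u`. -/
def quasiDeriv (Q : ℝ → ℝ) (u : ℝ → ℂ) (t : ℝ) : ℂ :=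
  deriv u t - Q t * u t

/-- The relation `H(p, Q) u = v`: the function `u` is absolutely continuous on `[0, ∞)`,
`v` is in `L¹_loc([0, ∞))` and, for some `α` and almost all `t`,
`u'(t) = α + Q(t) u(t) + ∫₀ᵗ (p u - Q u' - v)`. -/
structure IsSLImage (p Q : ℝ → ℝ) (u v : ℝ → ℂ) : Prop where
  ac : IsACHalfLine u
  locInt : LocallyIntegrableOn v (Ici (0 : ℝ)) volume
  eqn : ∃ α : ℂ, ∀ᵐ t ∂halfLine,
    quasiDeriv Q u t = α + ∫ y in (0 : ℝ)..t, (p y * u y - Q y * deriv u y - v y)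

/-- The bracket `[u₁, u₂] = u₁ u₂^[1] - u₁^[1] u₂`, which equals `u₁ u₂' - u₁' u₂`. -/
def bracket (Q : ℝ → ℝ) (u₁ u₂ : ℝ → ℂ) (t : ℝ) : ℂ :=
  u₁ t * quasiDeriv Q u₂ t - quasiDeriv Q u₁ t * u₂ t

/-- The maximal domain: `u(0) = 0`, `u ∈ L²(ℝ₊)`, and `H u` is defined and in `L²(ℝ₊)`. -/
def maxDomain (p Q : ℝ → ℝ) : Set (ℝ → ℂ) :=
  {u | u 0 = 0 ∧ MemLp u 2 halfLine ∧ ∃ v, IsSLImage p Q u v ∧ MemLp v 2 halfLine}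

/-- The minimal domain: those `u` in the maximal domain for which
`[u, v](t) → 0` as `t → ∞` for every `v` in the maximal domain. -/
def minDomain (p Q : ℝ → ℝ) : Set (ℝ → ℂ) :=
  {u | u ∈ maxDomain p Q ∧ ∀ v ∈ maxDomain p Q, Tendsto (bracket Q u v) atTop (𝓝 0)}

/-! ### The quadratic form -/

/-- `a(t) = ∫_t^{t+1} x(s) ds`. -/
def movingAverage (x : ℝ → ℝ) (t : ℝ) : ℝ :=
  ∫ s in t..(t + 1), x s

/-- The form domain `L`: the absolutely continuous `f` with `f(0) = 0` and
`∫₀^∞ (|f'|² + (1 + p) |f|²) dt < ∞`. -/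
def formDomain (p : ℝ → ℝ) : Set (ℝ → ℂ) :=
  {f | IsACHalfLine f ∧ f 0 = 0 ∧
    Integrable (fun t => ‖deriv f t‖ ^ 2 + (1 + p t) * ‖f t‖ ^ 2) halfLine}

/-- The integrand `u' v̄' + (p + c a') u v̄` of the first integral in the form. -/
def formIntegrand₁ (p : ℝ → ℝ) (c : ℝ) (x : ℝ → ℝ) (u v : ℝ → ℂ) (t : ℝ) : ℂ :=
  deriv u t * conj (deriv v t) +
    ((p t + c * deriv (movingAverage x) t : ℝ) : ℂ) * (u t * conj (v t))

/-- The integrand `c (x - a) (u v̄)'` of the second integral in the form. -/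
def formIntegrand₂ (c : ℝ) (x : ℝ → ℝ) (u v : ℝ → ℂ) (t : ℝ) : ℂ :=
  ((c * (x t - movingAverage x t) : ℝ) : ℂ) * deriv (fun s => u s * conj (v s)) t

/-- The sesquilinear form
`𝓔(u, v) = ∫₀^∞ (u' v̄' + (p + c a') u v̄) dt - ∫₀^∞ c (x - a) (u v̄)' dt`. -/
def airyForm (p : ℝ → ℝ) (c : ℝ) (x : ℝ → ℝ) (u v : ℝ → ℂ) : ℂ :=
  (∫ t, formIntegrand₁ p c x u v t ∂halfLine) - ∫ t, formIntegrand₂ c x u v t ∂halfLine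

/-- `𝓔(u, ψ) = (u, φ)` for all `u` in the form domain, with absolutely convergent
integrals on the left. -/
def IsFormImage (p : ℝ → ℝ) (c : ℝ) (x : ℝ → ℝ) (ψ φ : ℝ → ℂ) : Prop :=
  ∀ u ∈ formDomain p,
    Integrable (formIntegrand₁ p c x u ψ) halfLine ∧
    Integrable (formIntegrand₂ c x u ψ) halfLine ∧
    airyForm p c x u ψ = ∫ t, u t * conj (φ t) ∂halfLine

/-! ### Auxiliary facts on absolutely continuous functions -/

theorem IsACHalfLine.zero : IsACHalfLine 0 := fun T _ => by
  rw [absolutelyContinuousOnInterval_iff]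
  intro ε hε
  exact ⟨1, one_pos, fun E _ _ => by simp [hε]⟩

theorem IsACHalfLine.add {u v : ℝ → ℂ} (hu : IsACHalfLine u) (hv : IsACHalfLine v) :
    IsACHalfLine (u + v) := fun T hT => (hu T hT).add (hv T hT)

theorem IsACHalfLine.const_smul {u : ℝ → ℂ} (k : ℂ) (hu : IsACHalfLine u) :
    IsACHalfLine (k • u) := fun T hT => (hu T hT).const_smul k

theorem IsACHalfLine.continuousOn {u : ℝ → ℂ} (hu : IsACHalfLine u) :
    ContinuousOn u (Ici 0) := by
  intro t ht
  have h := (hu (t + 1) (by have := mem_Ici.1 ht; linarith)).continuousOn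
  have ht' : (0 : ℝ) ≤ t := ht
  rw [uIcc_of_le (by linarith)] at h
  have h1 := h t ⟨ht', by linarith⟩
  refine h1.mono_of_mem_nhdsWithin ?_
  rw [← Ici_inter_Iic]
  exact inter_mem self_mem_nhdsWithin
    (mem_nhdsWithin_of_mem_nhds (Iic_mem_nhds (by linarith)))

theorem IsACHalfLine.ae_differentiableAt {u : ℝ → ℂ} (hu : IsACHalfLine u) :
    ∀ᵐ t ∂halfLine, DifferentiableAt ℝ u t := by
  have h : ∀ n : ℕ, ∀ᵐ t, t ∈ uIcc (0 : ℝ) n → DifferentiableAt ℝ u t := fun n =>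
    (hu n (Nat.cast_nonneg n)).boundedVariationOn.ae_differentiableAt_of_mem_uIcc
  rw [ae_restrict_iff' measurableSet_Ioi]
  filter_upwards [ae_all_iff.2 h] with t ht h0
  obtain ⟨n, hn⟩ := exists_nat_ge t
  refine ht n ?_
  rw [uIcc_of_le (Nat.cast_nonneg n)]
  exact ⟨le_of_lt h0, hn⟩

theorem ac_comp_clm {u : ℝ → ℂ} {a b : ℝ} (L : ℂ →L[ℝ] ℝ)
    (hu : AbsolutelyContinuousOnInterval u a b) :
    AbsolutelyContinuousOnInterval (fun t => L (u t)) a b := by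
  refine squeeze_zero (fun E => Finset.sum_nonneg fun _ _ => dist_nonneg) (fun E => ?_)
    (by simpa using Tendsto.const_mul ‖L‖ hu)
  rw [Finset.mul_sum]
  refine Finset.sum_le_sum fun i _ => ?_
  rw [dist_eq_norm, dist_eq_norm, ← map_sub]
  exact L.le_opNorm _

theorem ae_deriv_clm {u : ℝ → ℂ} {T : ℝ} (L : ℂ →L[ℝ] ℝ)
    (hu : AbsolutelyContinuousOnInterval u 0 T) :
    ∀ᵐ t, t ∈ uIcc 0 T → deriv (fun s => L (u s)) t = L (deriv u t) := by
  filter_upwards [hu.boundedVariationOn.ae_differentiableAt_of_mem_uIcc] with t ht h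
  exact (L.hasFDerivAt.comp_hasDerivAt t (ht h).hasDerivAt).deriv

theorem IsACHalfLine.intervalIntegrable_deriv {u : ℝ → ℂ} (hu : IsACHalfLine u) {T : ℝ}
    (hT : 0 ≤ T) : IntervalIntegrable (deriv u) volume 0 T := by
  have hmem : ∀ L : ℂ →L[ℝ] ℝ, IntervalIntegrable (fun t => L (deriv u t)) volume 0 T := by
    intro L
    refine (ac_comp_clm L (hu T hT)).intervalIntegrable_deriv.congr_ae ?_
    rw [Filter.EventuallyEq, ae_restrict_iff' measurableSet_uIoc]
    filter_upwards [ae_deriv_clm L (hu T hT)] with t ht h using ht (uIoc_subset_uIcc h)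
  have h1 := hmem Complex.reCLM
  have h2 := hmem Complex.imCLM
  rw [intervalIntegrable_iff] at *
  have := h1.ofReal (𝕜 := ℂ) |>.add ((h2.ofReal (𝕜 := ℂ)).mul_const Complex.I)
  refine this.congr (Eventually.of_forall fun t => ?_)
  simpa using Complex.re_add_im (deriv u t)

theorem IsACHalfLine.integral_deriv {u : ℝ → ℂ} (hu : IsACHalfLine u) {T : ℝ}
    (hT : 0 ≤ T) : ∫ t in (0 : ℝ)..T, deriv u t = u T - u 0 := by
  have hi := hu.intervalIntegrable_deriv hT
  have key : ∀ L : ℂ →L[ℝ] ℝ, L (∫ t in (0 : ℝ)..T, deriv u t) = L (u T - u 0) := by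
    intro L
    rw [← L.intervalIntegral_comp_comm hi, map_sub,
      ← (ac_comp_clm L (hu T hT)).integral_deriv_eq_sub]
    refine intervalIntegral.integral_congr_ae ?_
    filter_upwards [ae_deriv_clm L (hu T hT)] with t ht h
    exact (ht (uIoc_subset_uIcc h)).symm
  exact Complex.ext (key Complex.reCLM) (key Complex.imCLM)

/-! ### The maximal and minimal operators -/

section SturmLiouville

variable {p Q : ℝ → ℝ}

theorem halfLine_restrict_ae {f g : ℝ → ℂ} (h : f =ᵐ[halfLine] g) (T : ℝ) (hT : 0 ≤ T) :
    f =ᵐ[volume.restrict (uIoc 0 T)] g := by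
  rw [uIoc_of_le hT]
  exact ae_mono (Measure.restrict_mono Ioc_subset_Ioi_self le_rfl) h

theorem intervalIntegrable_of_locInt {v : ℝ → ℂ}
    (hv : LocallyIntegrableOn v (Ici (0 : ℝ)) volume) {T : ℝ} (hT : 0 ≤ T) :
    IntervalIntegrable v volume 0 T := by
  rw [intervalIntegrable_iff_integrableOn_Icc_of_le hT]
  exact hv.integrableOn_compact_subset Icc_subset_Ici_self isCompact_Icc

theorem locInt_of_intervalIntegrable {v : ℝ → ℂ}
    (hv : ∀ T : ℝ, 0 ≤ T → IntervalIntegrable v volume 0 T) :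
    LocallyIntegrableOn v (Ici (0 : ℝ)) volume := by
  intro t ht
  have ht' : (0 : ℝ) ≤ t := ht
  refine ⟨Icc 0 (t + 1), ?_, ?_⟩
  · rw [← Ici_inter_Iic]
    exact inter_mem self_mem_nhdsWithin
      (mem_nhdsWithin_of_mem_nhds (Iic_mem_nhds (by linarith)))
  · exact (intervalIntegrable_iff_integrableOn_Icc_of_le (by linarith)).1
      (hv (t + 1) (by linarith))

theorem slIntegrand_intervalIntegrable (hp : ContinuousOn p (Ici 0))
    (hQ : ContinuousOn Q (Ici 0)) {u v : ℝ → ℂ} (hu : IsACHalfLine u)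
    (hv : LocallyIntegrableOn v (Ici (0 : ℝ)) volume) {T : ℝ} (hT : 0 ≤ T) :
    IntervalIntegrable (fun y => p y * u y - Q y * deriv u y - v y) volume 0 T := by
  have hsub : uIcc 0 T ⊆ Ici (0 : ℝ) := by
    rw [uIcc_of_le hT]; exact Icc_subset_Ici_self
  have hpc : ContinuousOn (fun y => (p y : ℂ)) (uIcc 0 T) :=
    Complex.continuous_ofReal.comp_continuousOn (hp.mono hsub)
  have hQc : ContinuousOn (fun y => (Q y : ℂ)) (uIcc 0 T) :=
    Complex.continuous_ofReal.comp_continuousOn (hQ.mono hsub)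
  exact ((hpc.mul (hu.continuousOn.mono hsub)).intervalIntegrable.sub
    ((hu.intervalIntegrable_deriv hT).continuousOn_mul hQc)).sub
    (intervalIntegrable_of_locInt hv hT)

theorem IsSLImage.congr {u v w : ℝ → ℂ} (h : IsSLImage p Q u v) (hvw : v =ᵐ[halfLine] w) :
    IsSLImage p Q u w := by
  refine ⟨h.ac, locInt_of_intervalIntegrable fun T hT => ?_, ?_⟩
  · exact (intervalIntegrable_of_locInt h.locInt hT).congr_ae (halfLine_restrict_ae hvw T hT)
  · obtain ⟨α, hα⟩ := h.eqn
    refine ⟨α, ?_⟩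
    filter_upwards [hα, ae_restrict_mem measurableSet_Ioi] with t ht h0
    rw [ht]
    congr 1
    refine intervalIntegral.integral_congr_ae_restrict ?_
    filter_upwards [halfLine_restrict_ae hvw t (le_of_lt h0)] with y hy
    rw [hy]

theorem IsSLImage.zero : IsSLImage p Q 0 0 := by
  refine ⟨IsACHalfLine.zero, locallyIntegrableOn_zero, 0, Eventually.of_forall fun t => ?_⟩
  have : deriv (0 : ℝ → ℂ) = 0 := by
    funext y; exact deriv_const y (0 : ℂ)
  simp [quasiDeriv, this]

theorem IsSLImage.add (hp : ContinuousOn p (Ici 0)) (hQ : ContinuousOn Q (Ici 0))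
    {u₁ u₂ v₁ v₂ : ℝ → ℂ} (h₁ : IsSLImage p Q u₁ v₁) (h₂ : IsSLImage p Q u₂ v₂) :
    IsSLImage p Q (u₁ + u₂) (v₁ + v₂) := by
  refine ⟨h₁.ac.add h₂.ac, h₁.locInt.add h₂.locInt, ?_⟩
  obtain ⟨α, hα⟩ := h₁.eqn
  obtain ⟨β, hβ⟩ := h₂.eqn
  refine ⟨α + β, ?_⟩
  have hd : deriv (u₁ + u₂) =ᵐ[halfLine] deriv u₁ + deriv u₂ := by
    filter_upwards [h₁.ac.ae_differentiableAt, h₂.ac.ae_differentiableAt] with t a b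
    exact deriv_add a b
  filter_upwards [hα, hβ, hd, ae_restrict_mem measurableSet_Ioi] with t ha hb hc h0
  have h0' : (0 : ℝ) ≤ t := le_of_lt h0
  have e : ∫ y in (0 : ℝ)..t,
      (p y * (u₁ + u₂) y - Q y * deriv (u₁ + u₂) y - (v₁ + v₂) y) =
      ∫ y in (0 : ℝ)..t, ((p y * u₁ y - Q y * deriv u₁ y - v₁ y) +
        (p y * u₂ y - Q y * deriv u₂ y - v₂ y)) := by
    refine intervalIntegral.integral_congr_ae_restrict ?_
    filter_upwards [halfLine_restrict_ae hd t h0'] with y hy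
    rw [hy]
    simp only [Pi.add_apply]
    ring
  rw [e, intervalIntegral.integral_add
    (slIntegrand_intervalIntegrable hp hQ h₁.ac h₁.locInt h0')
    (slIntegrand_intervalIntegrable hp hQ h₂.ac h₂.locInt h0')]
  simp only [quasiDeriv, Pi.add_apply] at *
  rw [hc]
  linear_combination ha + hb

theorem deriv_smul_fun (k : ℂ) (u : ℝ → ℂ) (t : ℝ) : deriv (k • u) t = k * deriv u t := by
  have h : (k • u) = fun s => k * u s := rfl
  rw [h, deriv_const_mul_field]

theorem IsSLImage.smul {u v : ℝ → ℂ} (k : ℂ) (h : IsSLImage p Q u v) :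
    IsSLImage p Q (k • u) (k • v) := by
  refine ⟨h.ac.const_smul k, h.locInt.smul k, ?_⟩
  obtain ⟨α, hα⟩ := h.eqn
  refine ⟨k * α, ?_⟩
  filter_upwards [hα] with t ha
  have e : ∀ y, (p y * (k • u) y - Q y * deriv (k • u) y - (k • v) y) =
      k * (p y * u y - Q y * deriv u y - v y) := fun y => by
    rw [deriv_smul_fun]; simp only [Pi.smul_apply, smul_eq_mul]; ring
  simp only [e, intervalIntegral.integral_const_mul]
  simp only [quasiDeriv, deriv_smul_fun, Pi.smul_apply, smul_eq_mul] at *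
  linear_combination k * ha

/-- A function in the domain of the expression is continuously differentiable on `(0, ∞)`, and
the defining equation holds at every point. -/
theorem IsSLImage.hasDerivAt (hp : ContinuousOn p (Ici 0)) (hQ : ContinuousOn Q (Ici 0))
    {u v : ℝ → ℂ} (h : IsSLImage p Q u v) :
    ∃ α : ℂ, ∀ t : ℝ, 0 < t → HasDerivAt u
      (Q t * u t + (α + ∫ y in (0 : ℝ)..t, (p y * u y - Q y * deriv u y - v y))) t := by
  obtain ⟨α, hα⟩ := h.eqn
  refine ⟨α, fun t ht => ?_⟩
  set F : ℝ → ℂ := fun t =>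
    Q t * u t + (α + ∫ y in (0 : ℝ)..t, (p y * u y - Q y * deriv u y - v y)) with hF
  have hFc : ContinuousOn F (Icc 0 (t + 1)) := by
    have hsub : Icc 0 (t + 1) ⊆ Ici (0 : ℝ) := Icc_subset_Ici_self
    have h1 : ContinuousOn (fun s => (Q s : ℂ) * u s) (Icc 0 (t + 1)) :=
      (Complex.continuous_ofReal.comp_continuousOn (hQ.mono hsub)).mul
        (h.ac.continuousOn.mono hsub)
    have hi := slIntegrand_intervalIntegrable hp hQ h.ac h.locInt
      (T := t + 1) (by linarith)
    have h2 := intervalIntegral.continuousOn_primitive_interval' hi left_mem_uIcc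
    rw [uIcc_of_le (by linarith)] at h2
    exact h1.add (continuousOn_const.add h2)
  have hFi : IntervalIntegrable F volume 0 t :=
    (hFc.mono (by rw [uIcc_of_le ht.le]; exact Icc_subset_Icc le_rfl (by linarith))).intervalIntegrable
  have hnhds : Icc 0 (t + 1) ∈ 𝓝 t := Icc_mem_nhds ht (by linarith)
  have hd : HasDerivAt (fun s => ∫ y in (0 : ℝ)..s, F y) (F t) t := by
    refine intervalIntegral.integral_hasDerivAt_right hFi ?_ (hFc.continuousAt hnhds)
    exact ⟨Icc 0 (t + 1), hnhds, hFc.aestronglyMeasurable measurableSet_Icc⟩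
  have heq : deriv u =ᵐ[halfLine] F := by
    filter_upwards [hα] with s hs
    simp only [quasiDeriv] at hs
    simp only [hF]
    linear_combination hs
  have hu : u =ᶠ[𝓝 t] fun s => u 0 + ∫ y in (0 : ℝ)..s, F y := by
    filter_upwards [Ioi_mem_nhds ht] with s hs
    have hs' : (0 : ℝ) ≤ s := le_of_lt hs
    rw [← intervalIntegral.integral_congr_ae_restrict (halfLine_restrict_ae heq s hs'),
      h.ac.integral_deriv hs']
    ring
  exact (hd.const_add (u 0)).congr_of_eventuallyEq hu

theorem IsSLImage.differentiableAt (hp : ContinuousOn p (Ici 0)) (hQ : ContinuousOn Q (Ici 0))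
    {u v : ℝ → ℂ} (h : IsSLImage p Q u v) {t : ℝ} (ht : 0 < t) : DifferentiableAt ℝ u t := by
  obtain ⟨α, hα⟩ := h.hasDerivAt hp hQ
  exact (hα t ht).differentiableAt

/-- Uniqueness of `H u`, in terms of the class of `u` modulo null functions. -/
theorem IsSLImage.unique (hp : ContinuousOn p (Ici 0)) (hQ : ContinuousOn Q (Ici 0))
    {u v : ℝ → ℂ} (h : IsSLImage p Q u v) (hu : u =ᵐ[halfLine] 0) : v =ᵐ[halfLine] 0 := by
  have hpos : ∀ t ∈ Ioi (0 : ℝ), u t = 0 := by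
    have := Measure.eqOn_open_of_ae_eq (μ := volume) hu isOpen_Ioi
      (h.ac.continuousOn.mono Ioi_subset_Ici_self) continuousOn_const
    exact this
  have hder : ∀ t ∈ Ioi (0 : ℝ), deriv u t = 0 := fun t ht => by
    have : u =ᶠ[𝓝 t] fun _ => (0 : ℂ) := by
      filter_upwards [Ioi_mem_nhds ht] with s hs using hpos s hs
    rw [this.deriv_eq, deriv_const]
  obtain ⟨α, hα⟩ := h.hasDerivAt hp hQ
  have key : ∀ t ∈ Ioi (0 : ℝ), ∫ y in (0 : ℝ)..t, v y = α := fun t ht => by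
    have h1 := (hα t ht).deriv
    rw [hder t ht, hpos t ht] at h1
    have e : ∫ y in (0 : ℝ)..t, (p y * u y - Q y * deriv u y - v y) =
        ∫ y in (0 : ℝ)..t, -v y := by
      refine intervalIntegral.integral_congr_ae (Eventually.of_forall fun y hy => ?_)
      rw [uIoc_of_le (le_of_lt ht)] at hy
      rw [hpos y hy.1, hder y hy.1]; ring
    rw [e, intervalIntegral.integral_neg] at h1
    linear_combination h1
  have hae : ∀ n : ℕ, ∀ᵐ t, t ∈ uIcc (0 : ℝ) n → ∀ c ∈ uIcc (0 : ℝ) n,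
      HasDerivAt (fun s => ∫ y in c..s, v y) (v t) t := fun n =>
    (intervalIntegrable_of_locInt h.locInt (Nat.cast_nonneg n)).ae_hasDerivAt_integral
  refine (ae_restrict_iff' measurableSet_Ioi).2 ?_
  filter_upwards [ae_all_iff.2 hae] with t ht h0
  obtain ⟨n, hn⟩ := exists_nat_ge t
  have h1 := ht n (by rw [uIcc_of_le (Nat.cast_nonneg n)]; exact ⟨le_of_lt h0, hn⟩) 0
    left_mem_uIcc
  have h2 : (fun s => ∫ y in (0 : ℝ)..s, v y) =ᶠ[𝓝 t] fun _ => α := by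
    filter_upwards [Ioi_mem_nhds h0] with s hs using key s hs
  have := h1.deriv
  rw [h2.deriv_eq, deriv_const] at this
  exact this.symm

theorem maxDomain_add (hp : ContinuousOn p (Ici 0)) (hQ : ContinuousOn Q (Ici 0))
    {u w : ℝ → ℂ} (hu : u ∈ maxDomain p Q) (hw : w ∈ maxDomain p Q) :
    u + w ∈ maxDomain p Q := by
  obtain ⟨a, b, v, c, d⟩ := hu
  obtain ⟨a', b', v', c', d'⟩ := hw
  exact ⟨by simp [a, a'], b.add b', v + v', c.add hp hQ c', d.add d'⟩

theorem maxDomain_smul {u : ℝ → ℂ} (k : ℂ) (hu : u ∈ maxDomain p Q) :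
    k • u ∈ maxDomain p Q := by
  obtain ⟨a, b, v, c, d⟩ := hu
  exact ⟨by simp [a], b.const_smul k, k • v, c.smul k, d.const_smul k⟩

theorem maxDomain_zero : (0 : ℝ → ℂ) ∈ maxDomain p Q :=
  ⟨rfl, MemLp.zero, 0, IsSLImage.zero, MemLp.zero⟩

theorem maxDomain_differentiableAt (hp : ContinuousOn p (Ici 0)) (hQ : ContinuousOn Q (Ici 0))
    {u : ℝ → ℂ} (hu : u ∈ maxDomain p Q) {t : ℝ} (ht : 0 < t) : DifferentiableAt ℝ u t := by
  obtain ⟨-, -, v, c, -⟩ := hu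
  exact c.differentiableAt hp hQ ht

theorem minDomain_add (hp : ContinuousOn p (Ici 0)) (hQ : ContinuousOn Q (Ici 0))
    {u w : ℝ → ℂ} (hu : u ∈ minDomain p Q) (hw : w ∈ minDomain p Q) :
    u + w ∈ minDomain p Q := by
  refine ⟨maxDomain_add hp hQ hu.1 hw.1, fun v hv => ?_⟩
  have := (hu.2 v hv).add (hw.2 v hv)
  rw [add_zero] at this
  refine this.congr' ?_
  filter_upwards [eventually_gt_atTop 0] with t ht
  simp only [bracket, quasiDeriv, Pi.add_apply]
  rw [deriv_add (maxDomain_differentiableAt hp hQ hu.1 ht)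
    (maxDomain_differentiableAt hp hQ hw.1 ht)]
  ring

theorem minDomain_smul {u : ℝ → ℂ} (k : ℂ) (hu : u ∈ minDomain p Q) :
    k • u ∈ minDomain p Q := by
  refine ⟨maxDomain_smul k hu.1, fun v hv => ?_⟩
  have := (hu.2 v hv).const_mul k
  rw [mul_zero] at this
  refine this.congr fun t => ?_
  simp only [bracket, quasiDeriv, deriv_smul_fun, Pi.smul_apply, smul_eq_mul]
  ring

theorem minDomain_zero : (0 : ℝ → ℂ) ∈ minDomain p Q := by
  refine ⟨maxDomain_zero, fun v _ => ?_⟩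
  have hd : deriv (0 : ℝ → ℂ) = 0 := by
    funext y; exact deriv_const y (0 : ℂ)
  have : bracket Q 0 v = fun _ => 0 := by
    funext t; simp [bracket, quasiDeriv, hd]
  rw [this]
  exact tendsto_const_nhds

/-- The graph of the maximal operator `H₀ = H|_{D₀}` in `L² × L²`. -/
def maxGraph (p Q : ℝ → ℝ) (hp : ContinuousOn p (Ici 0)) (hQ : ContinuousOn Q (Ici 0)) :
    Submodule ℂ (L2 × L2) where
  carrier := {x | ∃ u ∈ maxDomain p Q, x.1 =ᵐ[halfLine] u ∧ IsSLImage p Q u x.2}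
  zero_mem' := ⟨0, maxDomain_zero, Lp.coeFn_zero _ _ _,
    IsSLImage.zero.congr (Lp.coeFn_zero _ _ _).symm⟩
  add_mem' := by
    rintro x y ⟨u, hu, hxu, hi⟩ ⟨w, hw, hyw, hj⟩
    exact ⟨u + w, maxDomain_add hp hQ hu hw, (Lp.coeFn_add _ _).trans (hxu.add hyw),
      (hi.add hp hQ hj).congr (Lp.coeFn_add _ _).symm⟩
  smul_mem' := by
    rintro k x ⟨u, hu, hxu, hi⟩
    exact ⟨k • u, maxDomain_smul k hu, (Lp.coeFn_smul _ _).trans (hxu.const_smul k),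
      (hi.smul k).congr (Lp.coeFn_smul _ _).symm⟩

/-- The graph of the minimal operator `H₀^S = H|_{D₀^S}` in `L² × L²`. -/
def minGraph (p Q : ℝ → ℝ) (hp : ContinuousOn p (Ici 0)) (hQ : ContinuousOn Q (Ici 0)) :
    Submodule ℂ (L2 × L2) where
  carrier := {x | ∃ u ∈ minDomain p Q, x.1 =ᵐ[halfLine] u ∧ IsSLImage p Q u x.2}
  zero_mem' := ⟨0, minDomain_zero, Lp.coeFn_zero _ _ _,
    IsSLImage.zero.congr (Lp.coeFn_zero _ _ _).symm⟩
  add_mem' := by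
    rintro x y ⟨u, hu, hxu, hi⟩ ⟨w, hw, hyw, hj⟩
    exact ⟨u + w, minDomain_add hp hQ hu hw, (Lp.coeFn_add _ _).trans (hxu.add hyw),
      (hi.add hp hQ hj).congr (Lp.coeFn_add _ _).symm⟩
  smul_mem' := by
    rintro k x ⟨u, hu, hxu, hi⟩
    exact ⟨k • u, minDomain_smul k hu, (Lp.coeFn_smul _ _).trans (hxu.const_smul k),
      (hi.smul k).congr (Lp.coeFn_smul _ _).symm⟩

/-- `maxGraph` is the graph of a (single-valued) operator. -/
theorem maxGraph_functional (hp : ContinuousOn p (Ici 0)) (hQ : ContinuousOn Q (Ici 0))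
    (x : L2 × L2) (hx : x ∈ maxGraph p Q hp hQ) (h0 : x.1 = 0) : x.2 = 0 := by
  obtain ⟨u, -, hxu, hi⟩ := hx
  rw [h0] at hxu
  have hu : u =ᵐ[halfLine] 0 := hxu.symm.trans (Lp.coeFn_zero _ _ _)
  exact Lp.ext ((hi.unique hp hQ hu).trans (Lp.coeFn_zero _ _ _).symm)

/-- `minGraph` is the graph of a (single-valued) operator. -/
theorem minGraph_functional (hp : ContinuousOn p (Ici 0)) (hQ : ContinuousOn Q (Ici 0))
    (x : L2 × L2) (hx : x ∈ minGraph p Q hp hQ) (h0 : x.1 = 0) : x.2 = 0 := by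
  obtain ⟨u, hu, hxu, hi⟩ := hx
  exact maxGraph_functional hp hQ x ⟨u, hu.1, hxu, hi⟩ h0

/-- The maximal operator `H₀` in `L²(ℝ₊)` (Dirichlet condition at `0`). -/
def maxOperator (p Q : ℝ → ℝ) (hp : ContinuousOn p (Ici 0)) (hQ : ContinuousOn Q (Ici 0)) :
    L2 →ₗ.[ℂ] L2 :=
  (maxGraph p Q hp hQ).toLinearPMap

/-- The minimal operator `H₀^S` in `L²(ℝ₊)`. -/
def minOperator (p Q : ℝ → ℝ) (hp : ContinuousOn p (Ici 0)) (hQ : ContinuousOn Q (Ici 0)) :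
    L2 →ₗ.[ℂ] L2 :=
  (minGraph p Q hp hQ).toLinearPMap

end SturmLiouville

/-! ### The operator associated with the form -/

section Form

variable {p : ℝ → ℝ} {c : ℝ} {x : ℝ → ℝ}

theorem IsACHalfLine.aestronglyMeasurable {u : ℝ → ℂ} (hu : IsACHalfLine u) :
    AEStronglyMeasurable u halfLine :=
  (hu.continuousOn.mono Ioi_subset_Ici_self).aestronglyMeasurable measurableSet_Ioi

theorem weight_aestronglyMeasurable (hp : ContinuousOn p (Ici 0)) :
    AEStronglyMeasurable (fun t => 1 + p t) halfLine :=
  (continuousOn_const.add (hp.mono Ioi_subset_Ici_self)).aestronglyMeasurable measurableSet_Ioi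

theorem formDomain_zero : (0 : ℝ → ℂ) ∈ formDomain p := by
  refine ⟨IsACHalfLine.zero, rfl, ?_⟩
  have hd : deriv (0 : ℝ → ℂ) = 0 := by
    funext y; exact deriv_const y (0 : ℂ)
  simp [hd]

theorem formDomain_smul {u : ℝ → ℂ} (k : ℂ) (hu : u ∈ formDomain p) :
    k • u ∈ formDomain p := by
  obtain ⟨h1, h2, h3⟩ := hu
  refine ⟨h1.const_smul k, by simp [h2], (h3.const_mul (‖k‖ ^ 2)).congr ?_⟩
  refine Eventually.of_forall fun t => ?_
  simp only [deriv_smul_fun, Pi.smul_apply, smul_eq_mul, norm_mul]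
  ring

theorem formDomain_add (hp : ContinuousOn p (Ici 0)) (hp0 : ∀ t, 0 ≤ t → 0 ≤ p t)
    {u w : ℝ → ℂ} (hu : u ∈ formDomain p) (hw : w ∈ formDomain p) :
    u + w ∈ formDomain p := by
  obtain ⟨h1, h2, h3⟩ := hu
  obtain ⟨g1, g2, g3⟩ := hw
  refine ⟨h1.add g1, by simp [h2, g2], ((h3.add g3).const_mul 2).mono' ?_ ?_⟩
  · exact ((measurable_deriv (u + w)).aestronglyMeasurable.norm.pow 2).add
      ((weight_aestronglyMeasurable hp).mul ((h1.add g1).aestronglyMeasurable.norm.pow 2))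
  · filter_upwards [h1.ae_differentiableAt, g1.ae_differentiableAt,
      ae_restrict_mem measurableSet_Ioi] with t a b h0
    have hpt := hp0 t (le_of_lt h0)
    have sq : ∀ z w : ℂ, ‖z + w‖ ^ 2 ≤ 2 * (‖z‖ ^ 2 + ‖w‖ ^ 2) := fun z w => by
      have := norm_add_le z w
      nlinarith [norm_nonneg (z + w), sq_nonneg (‖z‖ - ‖w‖), norm_nonneg z, norm_nonneg w]
    rw [deriv_add a b, Real.norm_of_nonneg (by positivity)]
    simp only [Pi.add_apply]
    have e1 := sq (deriv u t) (deriv w t)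
    have e2 := mul_le_mul_of_nonneg_left (sq (u t) (w t)) (by linarith : 0 ≤ 1 + p t)
    linarith

theorem formDomain_memLp (hp0 : ∀ t, 0 ≤ t → 0 ≤ p t)
    {u : ℝ → ℂ} (hu : u ∈ formDomain p) : MemLp u 2 halfLine := by
  obtain ⟨h1, -, h3⟩ := hu
  rw [memLp_two_iff_integrable_sq_norm h1.aestronglyMeasurable]
  refine h3.mono' (h1.aestronglyMeasurable.norm.pow 2) ?_
  filter_upwards [ae_restrict_mem measurableSet_Ioi] with t h0
  have hpt := hp0 t (le_of_lt h0)
  rw [Real.norm_of_nonneg (by positivity)]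
  nlinarith [mul_nonneg hpt (sq_nonneg ‖u t‖), sq_nonneg ‖deriv u t‖]

theorem mul_conj_integrable {u φ : ℝ → ℂ} (hu : MemLp u 2 halfLine)
    (hφ : MemLp φ 2 halfLine) : Integrable (fun t => u t * conj (φ t)) halfLine :=
  hu.integrable_mul hφ.star

theorem deriv_mul_conj {u v : ℝ → ℂ} {t : ℝ} (hu : DifferentiableAt ℝ u t)
    (hv : DifferentiableAt ℝ v t) :
    deriv (fun s => u s * conj (v s)) t = deriv u t * conj (v t) + u t * conj (deriv v t) :=
  (hu.hasDerivAt.mul hv.hasDerivAt.star).deriv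

theorem IsFormImage.congr {ψ φ φ' : ℝ → ℂ} (h : IsFormImage p c x ψ φ)
    (hφ : φ =ᵐ[halfLine] φ') : IsFormImage p c x ψ φ' := fun u hu => by
  obtain ⟨h1, h2, h3⟩ := h u hu
  refine ⟨h1, h2, h3.trans (integral_congr_ae ?_)⟩
  filter_upwards [hφ] with t ht
  rw [ht]

theorem IsFormImage.zero : IsFormImage p c x 0 0 := fun u _ => by
  have hd : deriv (0 : ℝ → ℂ) = 0 := by
    funext y; exact deriv_const y (0 : ℂ)
  have e1 : formIntegrand₁ p c x u 0 = 0 := by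
    funext t; simp [formIntegrand₁, hd]
  have e2 : formIntegrand₂ c x u 0 = 0 := by
    funext t; simp [formIntegrand₂]
  simp [airyForm, e1, e2]

theorem IsFormImage.smul {ψ φ : ℝ → ℂ} (k : ℂ) (h : IsFormImage p c x ψ φ) :
    IsFormImage p c x (k • ψ) (k • φ) := fun u hu => by
  obtain ⟨h1, h2, h3⟩ := h u hu
  have e1 : formIntegrand₁ p c x u (k • ψ) = fun t => conj k * formIntegrand₁ p c x u ψ t := by
    funext t
    simp only [formIntegrand₁, deriv_smul_fun, Pi.smul_apply, smul_eq_mul, map_mul]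
    ring
  have e2 : formIntegrand₂ c x u (k • ψ) = fun t => conj k * formIntegrand₂ c x u ψ t := by
    funext t
    have : (fun s => u s * conj ((k • ψ) s)) = fun s => conj k * (u s * conj (ψ s)) := by
      funext s
      simp only [Pi.smul_apply, smul_eq_mul, map_mul]
      ring
    simp only [formIntegrand₂, this, deriv_const_mul_field]
    ring
  refine ⟨e1 ▸ h1.const_mul _, e2 ▸ h2.const_mul _, ?_⟩
  simp only [airyForm, e1, e2, integral_const_mul]
  rw [← mul_sub]
  change conj k * airyForm p c x u ψ = _
  rw [h3, ← integral_const_mul]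
  refine integral_congr_ae (Eventually.of_forall fun t => ?_)
  simp only [Pi.smul_apply, smul_eq_mul, map_mul]
  ring

theorem IsFormImage.add (hp0 : ∀ t, 0 ≤ t → 0 ≤ p t) {ψ₁ ψ₂ φ₁ φ₂ : ℝ → ℂ}
    (hψ₁ : IsACHalfLine ψ₁) (hψ₂ : IsACHalfLine ψ₂)
    (hφ₁ : MemLp φ₁ 2 halfLine) (hφ₂ : MemLp φ₂ 2 halfLine)
    (h : IsFormImage p c x ψ₁ φ₁) (g : IsFormImage p c x ψ₂ φ₂) :
    IsFormImage p c x (ψ₁ + ψ₂) (φ₁ + φ₂) := fun u hu => by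
  obtain ⟨h1, h2, h3⟩ := h u hu
  obtain ⟨g1, g2, g3⟩ := g u hu
  have e1 : formIntegrand₁ p c x u (ψ₁ + ψ₂) =ᵐ[halfLine]
      formIntegrand₁ p c x u ψ₁ + formIntegrand₁ p c x u ψ₂ := by
    filter_upwards [hψ₁.ae_differentiableAt, hψ₂.ae_differentiableAt] with t a b
    simp only [formIntegrand₁, Pi.add_apply, deriv_add a b, map_add]
    ring
  have e2 : formIntegrand₂ c x u (ψ₁ + ψ₂) =ᵐ[halfLine]
      formIntegrand₂ c x u ψ₁ + formIntegrand₂ c x u ψ₂ := by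
    filter_upwards [hψ₁.ae_differentiableAt, hψ₂.ae_differentiableAt,
      hu.1.ae_differentiableAt] with t a b d
    simp only [formIntegrand₂, Pi.add_apply]
    rw [deriv_mul_conj d a, deriv_mul_conj d b]
    have := deriv_mul_conj d (a.add b)
    simp only [Pi.add_apply] at this
    rw [this, deriv_add a b]
    simp only [map_add]
    ring
  refine ⟨(h1.add g1).congr e1.symm, (h2.add g2).congr e2.symm, ?_⟩
  have hm := formDomain_memLp hp0 hu
  have e3 : ∫ t, u t * conj ((φ₁ + φ₂) t) ∂halfLine =
      (∫ t, u t * conj (φ₁ t) ∂halfLine) + ∫ t, u t * conj (φ₂ t) ∂halfLine := by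
    rw [← integral_add (mul_conj_integrable hm hφ₁) (mul_conj_integrable hm hφ₂)]
    refine integral_congr_ae (Eventually.of_forall fun t => ?_)
    simp only [Pi.add_apply, map_add]
    ring
  rw [e3, ← h3, ← g3]
  simp only [airyForm]
  rw [integral_congr_ae e1, integral_congr_ae e2, integral_add' h1 g1, integral_add' h2 g2]
  ring

/-- Smooth functions with compact support in `(0, ∞)` belong to the form domain. -/
theorem testFunction_mem_formDomain (hp : ContinuousOn p (Ici 0)) {g : ℝ → ℝ}
    (hg : ContDiff ℝ 1 g) (hc : HasCompactSupport g) (hs : tsupport g ⊆ Ioi 0) :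
    (fun t => (g t : ℂ)) ∈ formDomain p := by
  have hgc : ContDiff ℝ 1 (fun t => (g t : ℂ)) := Complex.ofRealCLM.contDiff.comp hg
  refine ⟨fun T _ => hgc.contDiffOn.absolutelyContinuousOnInterval, ?_, ?_⟩
  · have : (0 : ℝ) ∉ tsupport g := fun h => lt_irrefl (0 : ℝ) (mem_Ioi.1 (hs h))
    simp [image_eq_zero_of_notMem_tsupport this]
  · set f : ℝ → ℝ := fun t => ‖deriv (fun t => (g t : ℂ)) t‖ ^ 2 + (1 + p t) * ‖(g t : ℂ)‖ ^ 2
    have hcont : ContinuousOn f (tsupport g) := by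
      have h1 : Continuous (deriv (fun t => (g t : ℂ))) := hgc.continuous_deriv le_rfl
      have h2 : ContinuousOn p (tsupport g) := hp.mono (hs.trans Ioi_subset_Ici_self)
      exact (h1.norm.pow 2).continuousOn.add ((continuousOn_const.add h2).mul
        (hgc.continuous.norm.pow 2).continuousOn)
    have hint : IntegrableOn f (tsupport g) volume := hcont.integrableOn_compact hc
    have hzero : ∀ t, t ∉ tsupport g → f t = 0 := by
      intro t ht
      have h0 : (fun t => (g t : ℂ)) =ᶠ[𝓝 t] fun _ => (0 : ℂ) := by
        filter_upwards [(isClosed_tsupport g).isOpen_compl.mem_nhds ht] with s hs'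
        simp [image_eq_zero_of_notMem_tsupport hs']
      simp only [f]
      rw [h0.deriv_eq, deriv_const, image_eq_zero_of_notMem_tsupport ht]
      simp
    exact ((integrableOn_iff_integrable_of_support_subset
      (Function.support_subset_iff'.2 hzero)).1 hint).integrableOn

/-- The graph of the operator associated with the form: `(ψ, φ)` belongs to it when `ψ` is in the
form domain and `𝓔(u, ψ) = (u, φ)` for every `u` in the form domain. -/
def formGraph (p : ℝ → ℝ) (c : ℝ) (x : ℝ → ℝ) (hp : ContinuousOn p (Ici 0))
    (hp0 : ∀ t, 0 ≤ t → 0 ≤ p t) : Submodule ℂ (L2 × L2) where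
  carrier := {y | ∃ ψ ∈ formDomain p, y.1 =ᵐ[halfLine] ψ ∧ IsFormImage p c x ψ y.2}
  zero_mem' := ⟨0, formDomain_zero, Lp.coeFn_zero _ _ _,
    IsFormImage.zero.congr (Lp.coeFn_zero _ _ _).symm⟩
  add_mem' := by
    rintro y z ⟨u, hu, hyu, hi⟩ ⟨w, hw, hzw, hj⟩
    exact ⟨u + w, formDomain_add hp hp0 hu hw, (Lp.coeFn_add _ _).trans (hyu.add hzw),
      (hi.add hp0 hu.1 hw.1 (Lp.memLp _) (Lp.memLp _) hj).congr (Lp.coeFn_add _ _).symm⟩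
  smul_mem' := by
    rintro k y ⟨u, hu, hyu, hi⟩
    exact ⟨k • u, formDomain_smul k hu, (Lp.coeFn_smul _ _).trans (hyu.const_smul k),
      (hi.smul k).congr (Lp.coeFn_smul _ _).symm⟩

/-- `formGraph` is the graph of a (single-valued) operator. -/
theorem formGraph_functional (hp : ContinuousOn p (Ici 0)) (hp0 : ∀ t, 0 ≤ t → 0 ≤ p t)
    (y : L2 × L2) (hy : y ∈ formGraph p c x hp hp0) (h0 : y.1 = 0) : y.2 = 0 := by
  obtain ⟨ψ, hψ, hyψ, hi⟩ := hy
  rw [h0] at hyψ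
  have hψ0 : ψ =ᵐ[halfLine] 0 := hyψ.symm.trans (Lp.coeFn_zero _ _ _)
  have hpos : ∀ t ∈ Ioi (0 : ℝ), ψ t = 0 :=
    Measure.eqOn_open_of_ae_eq (μ := volume) hψ0 isOpen_Ioi
      (hψ.1.continuousOn.mono Ioi_subset_Ici_self) continuousOn_const
  have hev : ∀ t ∈ Ioi (0 : ℝ), ψ =ᶠ[𝓝 t] fun _ => (0 : ℂ) := fun t ht => by
    filter_upwards [Ioi_mem_nhds ht] with s hs using hpos s hs
  have hform : ∀ u, airyForm p c x u ψ = 0 := fun u => by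
    have e1 : ∫ t, formIntegrand₁ p c x u ψ t ∂halfLine = 0 := by
      refine integral_eq_zero_of_ae ?_
      filter_upwards [ae_restrict_mem measurableSet_Ioi] with t ht
      simp [formIntegrand₁, hpos t ht, (hev t ht).deriv_eq]
    have e2 : ∫ t, formIntegrand₂ c x u ψ t ∂halfLine = 0 := by
      refine integral_eq_zero_of_ae ?_
      filter_upwards [ae_restrict_mem measurableSet_Ioi] with t ht
      have : (fun s => u s * conj (ψ s)) =ᶠ[𝓝 t] fun _ => (0 : ℂ) := by
        filter_upwards [hev t ht] with s hs
        simp [hs]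
      simp [formIntegrand₂, this.deriv_eq]
    simp [airyForm, e1, e2]
  have hmem : MemLp (y.2 : ℝ → ℂ) 2 halfLine := Lp.memLp _
  have hae : ∀ᵐ t, t ∈ Ioi (0 : ℝ) → conj ((y.2 : ℝ → ℂ) t) = 0 := by
    refine isOpen_Ioi.ae_eq_zero_of_integral_contDiff_smul_eq_zero ?_ ?_
    · rw [locallyIntegrableOn_iff isOpen_Ioi.isLocallyClosed]
      intro K hK hKc
      have h1 : MemLp (fun t => conj ((y.2 : ℝ → ℂ) t)) 2 (volume.restrict K) :=
        (hmem.star.mono_measure (Measure.restrict_mono hK le_rfl))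
      have : IsFiniteMeasure (volume.restrict K) :=
        ⟨by simpa using hKc.measure_lt_top⟩
      exact h1.integrable (by norm_num)
    · intro g hg hgc hgs
      have hd := testFunction_mem_formDomain hp (hg.of_le (by exact_mod_cast le_top)) hgc hgs
      obtain ⟨-, -, h3⟩ := hi _ hd
      rw [hform] at h3
      rw [← setIntegral_eq_integral_of_forall_compl_eq_zero (s := Ioi (0 : ℝ))]
      · simpa using h3.symm
      · intro t ht
        have : t ∉ tsupport g := fun h => ht (hgs h)
        simp [image_eq_zero_of_notMem_tsupport this]
  refine Lp.ext (EventuallyEq.trans ?_ (Lp.coeFn_zero _ _ _).symm)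
  refine (ae_restrict_iff' measurableSet_Ioi).2 ?_
  filter_upwards [hae] with t ht h
  simpa using ht h

/-- The operator `A` in `L²(ℝ₊)` associated with the form `𝓔`: its domain consists of the `ψ` in
the form domain for which some `φ ∈ L²(ℝ₊)` satisfies `𝓔(u, ψ) = (u, φ)` for all `u` in the form
domain, and `A ψ = φ`. -/
def formOperator (p : ℝ → ℝ) (c : ℝ) (x : ℝ → ℝ) (hp : ContinuousOn p (Ici 0))
    (hp0 : ∀ t, 0 ≤ t → 0 ≤ p t) : L2 →ₗ.[ℂ] L2 :=
  (formGraph p c x hp hp0).toLinearPMap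

end Form

/-! ### Fractional Brownian motion -/

/-- `X` is a fractional Brownian motion of Hurst parameter `h`: a centered Gaussian process with
`E[X(t) X(s)] = (t^{2h} + s^{2h} - |t - s|^{2h}) / 2`, all of whose paths are continuous and
start at `0`. -/
structure IsFractionalBrownianMotion {Ω : Type*} [MeasurableSpace Ω] (h : ℝ)
    (X : ℝ≥0 → Ω → ℝ) (P : Measure Ω) : Prop where
  zero : ∀ ω, X 0 ω = 0
  continuous : ∀ ω, Continuous fun t => X t ω
  gaussian : IsGaussianProcess X P
  centered : ∀ t, ∫ ω, X t ω ∂P = 0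
  covariance : ∀ t s : ℝ≥0, ∫ ω, X t ω * X s ω ∂P =
    ((t : ℝ) ^ (2 * h) + (s : ℝ) ^ (2 * h) - |(t : ℝ) - s| ^ (2 * h)) / 2

/-- The sample path `t ↦ X_ω(t)` (extended to negative times by `X_ω(0)`). -/
def path {Ω : Type*} (X : ℝ≥0 → Ω → ℝ) (ω : Ω) (t : ℝ) : ℝ :=
  X t.toNNReal ω

theorem IsFractionalBrownianMotion.continuousOn_path {Ω : Type*} [MeasurableSpace Ω] {h : ℝ}
    {X : ℝ≥0 → Ω → ℝ} {P : Measure Ω} (hX : IsFractionalBrownianMotion h X P) (c : ℝ) (ω : Ω) :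
    ContinuousOn (fun t => c * path X ω t) (Ici 0) :=
  (continuous_const.mul ((hX.continuous ω).comp continuous_real_toNNReal)).continuousOn

/-- The growth condition on a path `x`, with `a(t) = ∫_t^{t+1} x(s) ds`:
`a'(t) = O(√(log t))` and `x(t) - a(t) = O(√(log t))` as `t → ∞`. -/
def HasLogGrowth (x : ℝ → ℝ) : Prop :=
  (deriv (movingAverage x) =O[atTop] fun t => √(Real.log t)) ∧
    ((fun t => x t - movingAverage x t) =O[atTop] fun t => √(Real.log t))

end StochasticAiry

end

/-! Randomness plays no role beyond continuity of the path `x` and its logarithmic growth. Put `b =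
c a'` and `r = c (x - a)`. Since `p` eventually dominates a positive power of `t` while `b` and `r`
are `O(√(log t))`, there is a `K` with `|b| + 2 r² ≤ p / 2 + K` on the whole half-line
(`exists_coefficient_bound`).

Give the form domain the norm `‖f'‖² + ‖√(1 + p) f‖²`. Through `f ↦ (f', √(1 + p) f)` it is a closed
subspace of `L² ⊕ L²`, hence a Hilbert space (`isClosed_formSpace`). By the bound above, `𝓔` is
bounded and symmetric there, and adding `K + 1/2` times the squared `L²` norm makes it coercive.
Lax–Milgram then shows that the associated operator shifted by `K + 1/2` is onto, and a symmetric
operator with this property equals its adjoint (`adjoint_graph_eq_of_coercive`,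
`formGraph_adjoint_eq`).

Since `c x = r + c a`, integrating the `a` part by parts shows that `𝓔` is the weak form of `-d²/dt²
+ p + Q'` with `Q = c x`. Testing with functions of compact support, the du Bois-Reymond argument
turns the weak equation into the integrated equation defining `H`; this gives `A ⊂ H₀`
(`formGraph_le_maxGraph`).

The other inclusion follows by duality. The Lagrange identity and the vanishing of the bracket at
infinity give `H₀^S ⊂ H₀*`; adjoints reverse inclusions, so `H₀^S ⊂ H₀* ⊂ A* = A`. No energy
estimate for functions of the minimal domain is required. -/

noncomputable section

namespace StochasticAiry

/-! ### Self-adjointness of operators given by their graph -/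

section Abstract

variable {H V : Type*} [NormedAddCommGroup H] [InnerProductSpace ℂ H] [CompleteSpace H]
  [NormedAddCommGroup V] [InnerProductSpace ℂ V] [CompleteSpace V]

/-- A single-valued graph which is equal to its adjoint is the graph of a self-adjoint operator. -/
theorem isSelfAdjoint_toLinearPMap {G : Submodule ℂ (H × H)}
    (hfun : ∀ y ∈ G, y.1 = 0 → y.2 = 0) (hG : G.adjoint = G) :
    IsSelfAdjoint G.toLinearPMap := by
  -- If `a` is orthogonal to the domain, then `(0, a)` belongs to the adjoint graph, which is `G`;
  -- single-valuedness forces `a = 0`. Density is thus a consequence of the hypotheses.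
  have hd : Dense (G.toLinearPMap.domain : Set H) := by
    rw [Submodule.dense_iff_topologicalClosure_eq_top,
      Submodule.topologicalClosure_eq_top_iff, Submodule.eq_bot_iff]
    intro a ha
    have : ((0 : H), a) ∈ G.adjoint := by
      rw [Submodule.mem_adjoint_iff]
      intro x y hxy
      have : inner ℂ x a = 0 := ha x ⟨(x, y), hxy, rfl⟩
      simp [this]
    rw [hG] at this
    exact hfun _ this rfl
  rw [LinearPMap.isSelfAdjoint_def]
  apply LinearPMap.eq_of_eq_graph
  rw [LinearPMap.adjoint_graph_eq_graph_adjoint hd, Submodule.toLinearPMap_graph_eq G hfun, hG]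

/-- The graph of the operator associated with a closed symmetric form that is bounded below is
equal to its adjoint. The form is `⟪S ψ, u⟫` on the Hilbert space `V`, which is mapped to `H`
by `J`. -/
theorem adjoint_graph_eq_of_coercive (J : V →L[ℂ] H) (S : V →L[ℂ] V)
    (hS : ∀ u v, inner ℂ (S u) v = inner ℂ u (S v)) {δ K : ℝ} (hδ : 0 < δ)
    (hc : ∀ v, δ * ‖v‖ ^ 2 ≤ (inner ℂ (S v) v).re + K * ‖J v‖ ^ 2)
    {G : Submodule ℂ (H × H)}
    (hG : ∀ y, y ∈ G ↔ ∃ ψ, y.1 = J ψ ∧ ∀ u, inner ℂ (S ψ) u = inner ℂ y.2 (J u)) :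
    G.adjoint = G := by
  -- Lax–Milgram: `T = S + K J* J` is coercive, hence invertible. Solving `T ψ = J* φ` gives `S ψ =
  -- J* (φ - K J ψ)`, which says that `(J ψ, φ - K J ψ)` is in `G`.
  have hsurj : ∀ φ : H, ∃ y ∈ G, y.2 + (K : ℂ) • y.1 = φ := by
    intro φ
    set T : V →L[ℂ] V := S + (K : ℂ) • (J.adjoint ∘L J) with hT
    have hu : IsUnit T := by
      refine ContinuousLinearMap.isUnit_of_forall_le_norm_inner_map T (c := ⟨δ, hδ.le⟩) hδ
        fun v => ?_
      have h1 : (inner ℂ (T v) v).re = (inner ℂ (S v) v).re + K * ‖J v‖ ^ 2 := by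
        simp only [hT, add_apply, smul_apply,
          ContinuousLinearMap.comp_apply, inner_add_left, inner_smul_left,
          ContinuousLinearMap.adjoint_inner_left, inner_self_eq_norm_sq_to_K,
          Complex.conj_ofReal, Complex.add_re]
        norm_cast
        rw [Complex.re_ofReal_mul]
        rfl
      calc ‖v‖ ^ 2 * δ = δ * ‖v‖ ^ 2 := mul_comm _ _
        _ ≤ (inner ℂ (T v) v).re := (hc v).trans h1.ge
        _ ≤ ‖inner ℂ (T v) v‖ := Complex.re_le_norm _
    obtain ⟨ψ, hψ⟩ := ((ContinuousLinearMap.isUnit_iff_bijective).1 hu).2 (J.adjoint φ)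
    refine ⟨(J ψ, φ - (K : ℂ) • J ψ), (hG _).2 ⟨ψ, rfl, fun u => ?_⟩, by simp⟩
    have h2 : S ψ = J.adjoint (φ - (K : ℂ) • J ψ) := by
      rw [map_sub, map_smul, ← hψ]
      simp [hT]
    rw [h2, ContinuousLinearMap.adjoint_inner_left]
  refine le_antisymm ?_ ?_
  · intro x hx
    rw [Submodule.mem_adjoint_iff] at hx
    -- An element `z` of `G` with the same shifted image as `x`; it remains to see that `x = z`.
    obtain ⟨z, hz, hzx⟩ := hsurj (x.2 + (K : ℂ) • x.1)
    have hsymm : ∀ a b, (a, b) ∈ G → inner ℂ b z.1 - inner ℂ a z.2 = 0 := by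
      intro a b hab
      obtain ⟨α, h1, h2⟩ := (hG _).1 hab
      obtain ⟨ξ, h3, h4⟩ := (hG _).1 hz
      simp only at h1 h2
      rw [h3, h1, ← h2, ← inner_conj_symm (J α), ← h4, inner_conj_symm, hS, sub_self]
    -- By symmetry `x - z` is again in the adjoint, and it is annihilated by the shifted adjoint. So
    -- `x.1 - z.1` is orthogonal to the range of the shifted operator, which contains `x.1 - z.1`
    -- itself.
    have hd : x.1 - z.1 = 0 := by
      obtain ⟨y, hy, hyd⟩ := hsurj (x.1 - z.1)
      have e1 := hx y.1 y.2 hy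
      have e2 := hsymm y.1 y.2 hy
      have e3 : z.2 = x.2 + (K : ℂ) • (x.1 - z.1) := by
        rw [smul_sub, ← add_sub_assoc, ← hzx, add_sub_cancel_right]
      have : inner ℂ (x.1 - z.1) (x.1 - z.1) = (0 : ℂ) := by
        nth_rw 1 [← hyd]
        rw [e3] at e2
        simp only [inner_add_left, inner_add_right, inner_sub_right, inner_smul_left,
          inner_smul_right, Complex.conj_ofReal] at e2 ⊢
        linear_combination e1 - e2
      exact inner_self_eq_zero.1 this
    have h1 : x.1 = z.1 := sub_eq_zero.1 hd
    have h2 : x.2 = z.2 := by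
      rw [h1] at hzx
      exact (add_right_cancel hzx).symm
    have : x = z := Prod.ext h1 h2
    rwa [this]
  · intro z hz
    rw [Submodule.mem_adjoint_iff]
    intro a b hab
    obtain ⟨α, h1, h2⟩ := (hG _).1 hab
    obtain ⟨ξ, h3, h4⟩ := (hG _).1 hz
    simp only at h1 h2
    rw [h3, h1, ← h2, ← inner_conj_symm (J α), ← h4, inner_conj_symm, hS, sub_self]

end Abstract

/-! ### Further facts on absolutely continuous functions -/

theorem IsACHalfLine.congr {u v : ℝ → ℂ} (hu : IsACHalfLine u) (h : EqOn u v (Ici 0)) :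
    IsACHalfLine v := fun T hT => by
  have := hu T hT
  rw [absolutelyContinuousOnInterval_iff] at this ⊢
  intro ε hε
  obtain ⟨δ, hδ, hE⟩ := this ε hε
  refine ⟨δ, hδ, fun E hE' hl => ?_⟩
  refine lt_of_eq_of_lt (Finset.sum_congr rfl fun i hi => ?_) (hE E hE' hl)
  have hm := hE'.1 i hi
  rw [uIcc_of_le hT] at hm
  rw [h hm.1.1, h hm.2.1]

theorem IsACHalfLine.mul {u v : ℝ → ℂ} (hu : IsACHalfLine u) (hv : IsACHalfLine v) :
    IsACHalfLine (fun t => u t * v t) := fun T hT => (hu T hT).fun_smul (hv T hT)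

theorem IsACHalfLine.conj {u : ℝ → ℂ} (hu : IsACHalfLine u) :
    IsACHalfLine (fun t => conj (u t)) := fun T hT => by
  refine squeeze_zero (fun E => Finset.sum_nonneg fun _ _ => dist_nonneg) (fun E => ?_) (hu T hT)
  refine Finset.sum_le_sum fun i _ => ?_
  rw [dist_eq_norm, dist_eq_norm, ← map_sub, RCLike.norm_conj]

theorem isACHalfLine_ofReal {u : ℝ → ℝ}
    (hu : ∀ T : ℝ, 0 ≤ T → AbsolutelyContinuousOnInterval u 0 T) :
    IsACHalfLine (fun t => (u t : ℂ)) := fun T hT => by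
  refine squeeze_zero (fun E => Finset.sum_nonneg fun _ _ => dist_nonneg) (fun E => ?_) (hu T hT)
  refine Finset.sum_le_sum fun i _ => ?_
  rw [Complex.dist_eq, ← Complex.ofReal_sub, Complex.norm_real, dist_eq_norm]

/-- Reduction to real integrands through real and imaginary parts. The parts recombine to the
complex integral only for `t ≥ 0`, where `g` is known to be integrable; by `IsACHalfLine.congr` that
is enough. -/
theorem isACHalfLine_primitive {g : ℝ → ℂ}
    (hg : ∀ T : ℝ, 0 ≤ T → IntervalIntegrable g volume 0 T) :
    IsACHalfLine (fun t => ∫ s in (0 : ℝ)..t, g s) := by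
  have hL : ∀ (L : ℂ →L[ℝ] ℝ), IsACHalfLine (fun t => ((∫ s in (0 : ℝ)..t, L (g s) : ℝ) : ℂ)) := by
    intro L
    refine isACHalfLine_ofReal fun T hT => ?_
    refine IntervalIntegrable.absolutelyContinuousOnInterval_intervalIntegral ?_ left_mem_uIcc
    have := hg T hT
    rw [intervalIntegrable_iff] at this ⊢
    exact L.integrable_comp this
  have := (hL Complex.reCLM).add ((hL Complex.imCLM).const_smul Complex.I)
  refine this.congr fun t ht => ?_
  simp only [Pi.add_apply, Pi.smul_apply, smul_eq_mul]
  rw [Complex.reCLM.intervalIntegral_comp_comm (hg t ht),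
    Complex.imCLM.intervalIntegral_comp_comm (hg t ht), mul_comm]
  exact Complex.re_add_im _

theorem ae_deriv_primitive {g : ℝ → ℂ}
    (hg : ∀ T : ℝ, 0 ≤ T → IntervalIntegrable g volume 0 T) :
    ∀ᵐ t ∂halfLine, HasDerivAt (fun t => ∫ s in (0 : ℝ)..t, g s) (g t) t := by
  have hae : ∀ n : ℕ, ∀ᵐ t, t ∈ uIcc (0 : ℝ) n → ∀ c ∈ uIcc (0 : ℝ) n,
      HasDerivAt (fun s => ∫ y in c..s, g y) (g t) t := fun n =>
    (hg n (Nat.cast_nonneg n)).ae_hasDerivAt_integral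
  refine (ae_restrict_iff' measurableSet_Ioi).2 ?_
  filter_upwards [ae_all_iff.2 hae] with t ht h0
  obtain ⟨n, hn⟩ := exists_nat_ge t
  exact ht n (by rw [uIcc_of_le (Nat.cast_nonneg n)]; exact ⟨le_of_lt h0, hn⟩) 0 left_mem_uIcc

/-- The fundamental theorem of calculus for a function which is a.e. equal to the derivative. -/
theorem IsACHalfLine.integral_eq_of_ae {w g : ℝ → ℂ} (hw : IsACHalfLine w)
    (h : deriv w =ᵐ[halfLine] g) {T : ℝ} (hT : 0 ≤ T) :
    IntervalIntegrable g volume 0 T ∧ ∫ t in (0 : ℝ)..T, g t = w T - w 0 := by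
  have := halfLine_restrict_ae h T hT
  refine ⟨(hw.intervalIntegrable_deriv hT).congr_ae this, ?_⟩
  rw [← hw.integral_deriv hT]
  exact (intervalIntegral.integral_congr_ae_restrict this).symm

theorem IsACHalfLine.ae_hasDerivAt {u : ℝ → ℂ} (hu : IsACHalfLine u) :
    ∀ᵐ t ∂halfLine, HasDerivAt u (deriv u t) t := by
  filter_upwards [hu.ae_differentiableAt] with t ht using ht.hasDerivAt

theorem intervalIntegrable_of_memLp {g : ℝ → ℂ} (hg : MemLp g 2 halfLine) {T : ℝ}
    (hT : 0 ≤ T) : IntervalIntegrable g volume 0 T := by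
  rw [intervalIntegrable_iff, uIoc_of_le hT]
  have h1 : MemLp g 2 (volume.restrict (Ioc 0 T)) :=
    hg.mono_measure (Measure.restrict_mono Ioc_subset_Ioi_self le_rfl)
  exact h1.integrable (by norm_num)

/-! ### The form domain as a Hilbert space -/

section FormSpace

variable {p : ℝ → ℝ}

/-- Multiplication by a bounded real function is a bounded operator in `L²(ℝ₊)`. -/
theorem exists_mulOperator {m : ℝ → ℝ} (hm : ContinuousOn m (Ici 0)) {C : ℝ}
    (hC : ∀ t, 0 ≤ t → |m t| ≤ C) :
    ∃ M : L2 →L[ℂ] L2, ∀ f : L2, M f =ᵐ[halfLine] fun t => (m t : ℂ) * f t := by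
  have hmem : MemLp (fun t => (m t : ℂ)) ∞ halfLine := by
    refine memLp_top_of_bound ?_ C ?_
    · exact (Complex.continuous_ofReal.comp_continuousOn
        (hm.mono Ioi_subset_Ici_self)).aestronglyMeasurable measurableSet_Ioi
    · filter_upwards [ae_restrict_mem measurableSet_Ioi] with t ht
      rw [Complex.norm_real]
      exact hC t (le_of_lt ht)
  refine ⟨(ContinuousLinearMap.mul ℂ ℂ).holderL halfLine ∞ 2 2 hmem.toLp, fun f => ?_⟩
  rw [ContinuousLinearMap.holderL_apply_apply]
  filter_upwards [(ContinuousLinearMap.mul ℂ ℂ).coeFn_holder (r := 2) hmem.toLp f,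
    hmem.coeFn_toLp] with t h1 h2
  rw [h1, h2, ContinuousLinearMap.mul_apply']

theorem inner_mulOperator {M : L2 →L[ℂ] L2} {m : ℝ → ℝ}
    (hM : ∀ f : L2, M f =ᵐ[halfLine] fun t => (m t : ℂ) * f t) (f g : L2) :
    inner ℂ (M f) g = inner ℂ f (M g) := by
  rw [L2.inner_def, L2.inner_def]
  refine integral_congr_ae ?_
  filter_upwards [hM f, hM g] with t h1 h2
  simp only [h1, h2, RCLike.inner_apply, map_mul, Complex.conj_ofReal]
  ring

/-- The integral over `(0, t]` is the inner product with an indicator function, hence continuous on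
`L²`. Convergence of derivatives in `L²` therefore gives pointwise convergence of primitives. -/
theorem tendsto_intervalIntegral_of_tendsto {g : ℕ → L2} {g₀ : L2}
    (hg : Tendsto g atTop (𝓝 g₀)) {t : ℝ} (ht : 0 ≤ t) :
    Tendsto (fun n => ∫ s in (0 : ℝ)..t, g n s) atTop (𝓝 (∫ s in (0 : ℝ)..t, g₀ s)) := by
  have hs : MeasurableSet (Ioc 0 t) := measurableSet_Ioc
  have hfin : halfLine (Ioc 0 t) ≠ ∞ :=
    ((Measure.restrict_apply_le _ _).trans_lt measure_Ioc_lt_top).ne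
  have e : ∀ f : L2, ∫ s in (0 : ℝ)..t, f s =
      inner ℂ (indicatorConstLp 2 hs hfin (1 : ℂ)) f := fun f => by
    rw [L2.inner_indicatorConstLp_one, intervalIntegral.integral_of_le ht,
      Measure.restrict_restrict hs, inter_eq_left.2 Ioc_subset_Ioi_self]
  simp only [e]
  exact tendsto_const_nhds.inner hg

/-- The form domain as a subspace of `L² ⊕ L²`, through `f ↦ (f', √(1 + p) f)`. -/
def formSpace (p : ℝ → ℝ) (hp : ContinuousOn p (Ici 0)) (hp0 : ∀ t, 0 ≤ t → 0 ≤ p t) :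
    Submodule ℂ (WithLp 2 (L2 × L2)) where
  carrier := {w | ∃ f ∈ formDomain p, w.fst =ᵐ[halfLine] deriv f ∧
    w.snd =ᵐ[halfLine] fun t => (√(1 + p t) : ℂ) * f t}
  zero_mem' := by
    refine ⟨0, formDomain_zero, (Lp.coeFn_zero _ _ _).trans (Eventually.of_forall fun t => ?_),
      (Lp.coeFn_zero _ _ _).trans (Eventually.of_forall fun t => ?_)⟩
    · exact (deriv_const t (0 : ℂ)).symm
    · simp
  add_mem' := by
    rintro w z ⟨f, hf, h1, h2⟩ ⟨g, hg, h3, h4⟩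
    refine ⟨f + g, formDomain_add hp hp0 hf hg, ?_, ?_⟩
    · filter_upwards [Lp.coeFn_add w.fst z.fst, h1, h3, hf.1.ae_differentiableAt,
        hg.1.ae_differentiableAt] with t a b c d e
      rw [WithLp.add_fst, a, Pi.add_apply, b, c, deriv_add d e]
    · filter_upwards [Lp.coeFn_add w.snd z.snd, h2, h4] with t a b c
      rw [WithLp.add_snd, a, Pi.add_apply, b, c, Pi.add_apply, mul_add]
  smul_mem' := by
    rintro k w ⟨f, hf, h1, h2⟩
    refine ⟨k • f, formDomain_smul k hf, ?_, ?_⟩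
    · filter_upwards [Lp.coeFn_smul k w.fst, h1] with t a b
      rw [WithLp.smul_fst, a, Pi.smul_apply, b, deriv_smul_fun, smul_eq_mul]
    · filter_upwards [Lp.coeFn_smul k w.snd, h2] with t a b
      rw [WithLp.smul_snd, a, Pi.smul_apply, b, Pi.smul_apply, smul_eq_mul, smul_eq_mul]
      ring

theorem sqrt_weight_aestronglyMeasurable (hp : ContinuousOn p (Ici 0)) :
    AEStronglyMeasurable (fun t => (√(1 + p t) : ℂ)) halfLine :=
  (Complex.continuous_ofReal.comp_continuousOn (Real.continuous_sqrt.comp_continuousOn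
    (continuousOn_const.add (hp.mono Ioi_subset_Ici_self)))).aestronglyMeasurable measurableSet_Ioi

theorem sqrt_weight_sq (hp0 : ∀ t, 0 ≤ t → 0 ≤ p t) {t : ℝ} (ht : 0 < t) (z : ℂ) :
    ‖(√(1 + p t) : ℂ) * z‖ ^ 2 = (1 + p t) * ‖z‖ ^ 2 := by
  rw [norm_mul, mul_pow, Complex.norm_real, Real.norm_eq_abs, sq_abs,
    Real.sq_sqrt (by linarith [hp0 t ht.le])]

theorem formDomain_deriv_memLp (hp0 : ∀ t, 0 ≤ t → 0 ≤ p t) {f : ℝ → ℂ} (hf : f ∈ formDomain p) :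
    MemLp (deriv f) 2 halfLine := by
  have hmeas := (measurable_deriv f).aestronglyMeasurable (μ := halfLine)
  rw [memLp_two_iff_integrable_sq_norm hmeas]
  refine hf.2.2.mono' (hmeas.norm.pow 2) ?_
  filter_upwards [ae_restrict_mem measurableSet_Ioi] with t h0
  have hpt := hp0 t (le_of_lt h0)
  rw [Real.norm_of_nonneg (by positivity)]
  have : 0 ≤ (1 + p t) * ‖f t‖ ^ 2 := by positivity
  linarith

theorem formDomain_sqrt_weight_memLp (hp : ContinuousOn p (Ici 0)) (hp0 : ∀ t, 0 ≤ t → 0 ≤ p t)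
    {f : ℝ → ℂ} (hf : f ∈ formDomain p) :
    MemLp (fun t => (√(1 + p t) : ℂ) * f t) 2 halfLine := by
  have hmeas := (sqrt_weight_aestronglyMeasurable hp).mul hf.1.aestronglyMeasurable
  refine (memLp_two_iff_integrable_sq_norm hmeas).2 (hf.2.2.mono' (hmeas.norm.pow 2) ?_)
  filter_upwards [ae_restrict_mem measurableSet_Ioi] with t h0
  rw [Real.norm_of_nonneg (by positivity)]
  simp only [Pi.mul_apply]
  rw [sqrt_weight_sq hp0 h0]
  linarith [sq_nonneg ‖deriv f t‖]

theorem exists_mem_formSpace (hp : ContinuousOn p (Ici 0)) (hp0 : ∀ t, 0 ≤ t → 0 ≤ p t)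
    {f : ℝ → ℂ} (hf : f ∈ formDomain p) :
    ∃ w ∈ formSpace p hp hp0, w.fst =ᵐ[halfLine] deriv f ∧
      w.snd =ᵐ[halfLine] fun t => (√(1 + p t) : ℂ) * f t := by
  have h1 := (formDomain_deriv_memLp hp0 hf).coeFn_toLp
  have h2 := (formDomain_sqrt_weight_memLp hp hp0 hf).coeFn_toLp
  exact ⟨WithLp.toLp 2 (_, _), ⟨f, hf, h1, h2⟩, h1, h2⟩

/-- An absolutely continuous `f` with `f(0) = 0` is the primitive of its derivative. -/
theorem IsACHalfLine.eq_primitive {f : ℝ → ℂ} (hf : IsACHalfLine f) (h0 : f 0 = 0) {g : ℝ → ℂ}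
    (hg : g =ᵐ[halfLine] deriv f) {t : ℝ} (ht : 0 ≤ t) : f t = ∫ s in (0 : ℝ)..t, g s := by
  rw [intervalIntegral.integral_congr_ae_restrict (halfLine_restrict_ae hg t ht),
    hf.integral_deriv ht, h0, sub_zero]

/-- The form domain contains the primitives of square integrable functions, as soon as the
weighted norm is finite. -/
theorem primitive_mem_formDomain (hp0 : ∀ t, 0 ≤ t → 0 ≤ p t) {g k : ℝ → ℂ}
    (hg : MemLp g 2 halfLine) (hk : MemLp k 2 halfLine)
    (h : k =ᵐ[halfLine] fun t => (√(1 + p t) : ℂ) * ∫ s in (0 : ℝ)..t, g s) :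
    (fun t => ∫ s in (0 : ℝ)..t, g s) ∈ formDomain p ∧
      g =ᵐ[halfLine] deriv fun t => ∫ s in (0 : ℝ)..t, g s := by
  have hi : ∀ T : ℝ, 0 ≤ T → IntervalIntegrable g volume 0 T :=
    fun T hT => intervalIntegrable_of_memLp hg hT
  have hd : g =ᵐ[halfLine] deriv fun t => ∫ s in (0 : ℝ)..t, g s := by
    filter_upwards [ae_deriv_primitive hi] with t ht using ht.deriv.symm
  refine ⟨⟨isACHalfLine_primitive hi, by simp, ?_⟩, hd⟩
  refine (((memLp_two_iff_integrable_sq_norm hg.1).1 hg).add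
    ((memLp_two_iff_integrable_sq_norm hk.1).1 hk)).congr ?_
  filter_upwards [hd, h, ae_restrict_mem measurableSet_Ioi] with t h1 h2 h3
  simp only [Pi.add_apply]
  rw [h2, sqrt_weight_sq hp0 h3, ← h1]

/-- If the derivatives `f_n'` converge in `L²`, then the `f_n` converge at every `t` to the
primitive of the limit. Along a subsequence `√(1 + p) f_n` also converges almost everywhere, so the
second component of the limit is `√(1 + p)` times the primitive of the first. -/
theorem isClosed_formSpace (hp : ContinuousOn p (Ici 0)) (hp0 : ∀ t, 0 ≤ t → 0 ≤ p t) :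
    IsClosed (formSpace p hp hp0 : Set (WithLp 2 (L2 × L2))) := by
  refine IsSeqClosed.isClosed fun w w₀ hw hlim => ?_
  choose f hf h1 h2 using hw
  have hfst : Tendsto (fun n => (w n).fst) atTop (𝓝 w₀.fst) :=
    ((WithLp.fstL 2 ℂ L2 L2).continuous.tendsto _).comp hlim
  have hsnd : Tendsto (fun n => (w n).snd) atTop (𝓝 w₀.snd) :=
    ((WithLp.sndL 2 ℂ L2 L2).continuous.tendsto _).comp hlim
  obtain ⟨ns, hns, hae⟩ := (tendstoInMeasure_of_tendsto_Lp hsnd).exists_seq_tendsto_ae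
  have key : w₀.snd =ᵐ[halfLine] fun t => (√(1 + p t) : ℂ) * ∫ s in (0 : ℝ)..t, w₀.fst s := by
    filter_upwards [hae, ae_all_iff.2 h2, ae_restrict_mem measurableSet_Ioi] with t ha hb h0
    refine tendsto_nhds_unique ha ?_
    simp only [hb]
    refine Tendsto.const_mul _ ?_
    have := (tendsto_intervalIntegral_of_tendsto hfst (le_of_lt h0)).comp hns.tendsto_atTop
    refine this.congr fun i => ?_
    exact ((hf (ns i)).1.eq_primitive (hf (ns i)).2.1 (h1 (ns i)) (le_of_lt h0)).symm
  obtain ⟨a, b⟩ := primitive_mem_formDomain hp0 (Lp.memLp w₀.fst) (Lp.memLp w₀.snd) key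
  exact ⟨_, a, b, key⟩

end FormSpace

/-! ### Self-adjointness of the operator associated with the form -/

section FormOperator

variable {p : ℝ → ℝ} {c : ℝ} {x : ℝ → ℝ}

/-- Dictionary between the inner product, conjugate-linear in its first argument, and the form,
conjugate-linear in its second; hence the reversed order of `f` and `g`. -/
theorem integrable_inner_and_eq {f g : L2} {f' g' : ℝ → ℂ} (hf : f =ᵐ[halfLine] f')
    (hg : g =ᵐ[halfLine] g') :
    Integrable (fun t => g' t * conj (f' t)) halfLine ∧
      inner ℂ f g = ∫ t, g' t * conj (f' t) ∂halfLine := by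
  have e : (fun t => inner ℂ (f t) (g t)) =ᵐ[halfLine] fun t => g' t * conj (f' t) := by
    filter_upwards [hf, hg] with t h1 h2
    rw [h1, h2, RCLike.inner_apply]
  exact ⟨(L2.integrable_inner f g).congr e, by rw [L2.inner_def, integral_congr_ae e]⟩

theorem sqrt_weight_pos (hp0 : ∀ t, 0 ≤ t → 0 ≤ p t) {t : ℝ} (ht : 0 ≤ t) : 0 < √(1 + p t) :=
  Real.sqrt_pos.2 (by linarith [hp0 t ht])

/-- The form `𝓔` in terms of the bounded operators `M₁` and `M₂` of multiplication by
`(p + c a') / (1 + p)` and by `c (x - a) / √(1 + p)`. -/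
theorem airyForm_eq_inner (hp0 : ∀ t, 0 ≤ t → 0 ≤ p t) {M₁ M₂ : L2 →L[ℂ] L2}
    (hM₁ : ∀ f : L2, M₁ f =ᵐ[halfLine] fun t =>
      (((p t + c * deriv (movingAverage x) t) / (1 + p t) : ℝ) : ℂ) * f t)
    (hM₂ : ∀ f : L2, M₂ f =ᵐ[halfLine] fun t =>
      ((c * (x t - movingAverage x t) / √(1 + p t) : ℝ) : ℂ) * f t)
    {u ψ : ℝ → ℂ} (hu : IsACHalfLine u) (hψ : IsACHalfLine ψ) {g k g' k' : L2}
    (hg : g =ᵐ[halfLine] deriv ψ) (hk : k =ᵐ[halfLine] fun t => (√(1 + p t) : ℂ) * ψ t)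
    (hg' : g' =ᵐ[halfLine] deriv u) (hk' : k' =ᵐ[halfLine] fun t => (√(1 + p t) : ℂ) * u t) :
    Integrable (formIntegrand₁ p c x u ψ) halfLine ∧
    Integrable (formIntegrand₂ c x u ψ) halfLine ∧
    airyForm p c x u ψ =
      inner ℂ g g' + inner ℂ (M₁ k) k' - (inner ℂ (M₂ k) g' + inner ℂ (M₂ g) k') := by
  have hM₁k : M₁ k =ᵐ[halfLine] fun t =>
      ((p t + c * deriv (movingAverage x) t : ℝ) : ℂ) * ψ t / √(1 + p t) := by
    filter_upwards [hM₁ k, hk, ae_restrict_mem measurableSet_Ioi] with t h1 h2 h3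
    have hs := sqrt_weight_pos hp0 (le_of_lt h3)
    have hs' : (√(1 + p t) : ℂ) ≠ 0 := by exact_mod_cast hs.ne'
    have hsq : (1 + p t : ℝ) = √(1 + p t) ^ 2 :=
      (Real.sq_sqrt (by linarith [hp0 t (le_of_lt h3)])).symm
    rw [h1, h2, Complex.ofReal_div, congrArg Complex.ofReal hsq]
    push_cast
    field_simp
  have hM₂k : M₂ k =ᵐ[halfLine] fun t => ((c * (x t - movingAverage x t) : ℝ) : ℂ) * ψ t := by
    filter_upwards [hM₂ k, hk, ae_restrict_mem measurableSet_Ioi] with t h1 h2 h3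
    have hs := sqrt_weight_pos hp0 (le_of_lt h3)
    have hs' : (√(1 + p t) : ℂ) ≠ 0 := by exact_mod_cast hs.ne'
    rw [h1, h2, Complex.ofReal_div]
    field_simp
  have hM₂g : M₂ g =ᵐ[halfLine] fun t =>
      ((c * (x t - movingAverage x t) : ℝ) : ℂ) * deriv ψ t / √(1 + p t) := by
    filter_upwards [hM₂ g, hg] with t h1 h2
    rw [h1, h2, Complex.ofReal_div]
    ring
  obtain ⟨i1, e1⟩ := integrable_inner_and_eq hg hg'
  obtain ⟨i2, e2⟩ := integrable_inner_and_eq hM₁k hk'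
  obtain ⟨i3, e3⟩ := integrable_inner_and_eq hM₂k hg'
  obtain ⟨i4, e4⟩ := integrable_inner_and_eq hM₂g hk'
  have a1 : (fun t => deriv u t * conj (deriv ψ t) + (√(1 + p t) : ℂ) * u t *
      conj (((p t + c * deriv (movingAverage x) t : ℝ) : ℂ) * ψ t / √(1 + p t)))
      =ᵐ[halfLine] formIntegrand₁ p c x u ψ := by
    filter_upwards [ae_restrict_mem measurableSet_Ioi] with t h3
    have hs := sqrt_weight_pos hp0 (le_of_lt h3)
    have hs' : (√(1 + p t) : ℂ) ≠ 0 := by exact_mod_cast hs.ne'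
    simp only [formIntegrand₁, map_div₀, map_mul, Complex.conj_ofReal]
    field_simp
  -- The Leibniz rule splits `(u ψ̄)'` into two terms. In each, the undifferentiated function
  -- carries the weight `√(1 + p)` which the multiplier of `M₂` divides out.
  have a2 : (fun t => deriv u t * conj (((c * (x t - movingAverage x t) : ℝ) : ℂ) * ψ t) +
      (√(1 + p t) : ℂ) * u t *
        conj (((c * (x t - movingAverage x t) : ℝ) : ℂ) * deriv ψ t / √(1 + p t)))
      =ᵐ[halfLine] formIntegrand₂ c x u ψ := by
    filter_upwards [ae_restrict_mem measurableSet_Ioi, hu.ae_differentiableAt,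
      hψ.ae_differentiableAt] with t h3 h4 h5
    have hs := sqrt_weight_pos hp0 (le_of_lt h3)
    have hs' : (√(1 + p t) : ℂ) ≠ 0 := by exact_mod_cast hs.ne'
    simp only [formIntegrand₂, map_div₀, map_mul, Complex.conj_ofReal]
    rw [deriv_mul_conj h4 h5]
    field_simp
  refine ⟨(i1.add i2).congr a1, (i3.add i4).congr a2, ?_⟩
  rw [airyForm, ← integral_congr_ae a1, ← integral_congr_ae a2, integral_add i1 i2,
    integral_add i3 i4, e1, e2, e3, e4]

/-- The pointwise lower bound behind the semiboundedness of the form. -/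
theorem form_pointwise_bound {P b r K : ℝ} (hK : |b| + 2 * r ^ 2 ≤ P / 2 + K)
    (g f : ℂ) :
    1 / 2 * (‖g‖ ^ 2 + (1 + P) * ‖f‖ ^ 2) ≤
      ‖g‖ ^ 2 + (P + b) * ‖f‖ ^ 2 - 2 * r * (g * conj f).re + (K + 1 / 2) * ‖f‖ ^ 2 := by
  have h1 : |r * (g * conj f).re| ≤ |r| * (‖g‖ * ‖f‖) := by
    rw [abs_mul]
    refine mul_le_mul_of_nonneg_left ((Complex.abs_re_le_norm _).trans ?_) (abs_nonneg _)
    rw [norm_mul, RCLike.norm_conj]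
  have h2 := (abs_le.1 h1).2
  have h3 := (abs_le.1 (le_refl |b|)).1
  -- Doubled, this estimate uses half of `‖g‖²` and costs `2 r² ‖f‖²`, which explains the term `2
  -- r²` in the hypothesis. The additional `1/2` beside `K` pays for the `1` in the weight `1 + P`.
  have h4 : |r| * (‖g‖ * ‖f‖) ≤ 1 / 4 * ‖g‖ ^ 2 + r ^ 2 * ‖f‖ ^ 2 := by
    have := sq_nonneg (1 / 2 * ‖g‖ - |r| * ‖f‖)
    rw [← sq_abs r]
    linarith
  have h5 : 0 ≤ (P / 2 + K + b - 2 * r ^ 2) * ‖f‖ ^ 2 :=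
    mul_nonneg (by linarith) (sq_nonneg _)
  linarith

/-- The compression to `V` of the operator with blocks `1`, `-M₂`, `-M₂`, `M₁`. -/
theorem exists_blockOperator (M₁ M₂ : L2 →L[ℂ] L2) (V : Submodule ℂ (WithLp 2 (L2 × L2)))
    [CompleteSpace V] :
    ∃ S : V →L[ℂ] V, ∀ w z : V, inner ℂ (S w) z = inner ℂ w.1.fst z.1.fst +
      inner ℂ (M₁ w.1.snd) z.1.snd - (inner ℂ (M₂ w.1.snd) z.1.fst +
        inner ℂ (M₂ w.1.fst) z.1.snd) := by
  let F₁ : WithLp 2 (L2 × L2) →L[ℂ] L2 := WithLp.fstL 2 ℂ L2 L2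
  let F₂ : WithLp 2 (L2 × L2) →L[ℂ] L2 := WithLp.sndL 2 ℂ L2 L2
  obtain ⟨S₀, hS₀⟩ : ∃ S₀ : WithLp 2 (L2 × L2) →L[ℂ] WithLp 2 (L2 × L2),
      ∀ w, S₀ w = WithLp.toLp 2 (w.fst - M₂ w.snd, M₁ w.snd - M₂ w.fst) :=
    ⟨((WithLp.prodContinuousLinearEquiv 2 ℂ L2 L2).symm : L2 × L2 →L[ℂ] WithLp 2 (L2 × L2)) ∘L
      ((F₁ - M₂ ∘L F₂).prod (M₁ ∘L F₂ - M₂ ∘L F₁)), fun w => rfl⟩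
  -- `V` need not be invariant under the block operator; projecting back does not change inner
  -- products with elements of `V`.
  refine ⟨V.orthogonalProjectionOnto ∘L S₀ ∘L V.subtypeL, fun w z => ?_⟩
  have : inner ℂ ((V.orthogonalProjectionOnto ∘L S₀ ∘L V.subtypeL) w) z =
      inner ℂ (S₀ w.1) z.1 :=
    Submodule.inner_orthogonalProjectionOnto_eq_of_mem_right z (S₀ w.1)
  rw [this, hS₀, WithLp.prod_inner_apply]
  change inner ℂ (w.1.fst - M₂ w.1.snd) z.1.fst +
    inner ℂ (M₁ w.1.snd - M₂ w.1.fst) z.1.snd = _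
  rw [inner_sub_left, inner_sub_left]
  ring

/-- Under a relative bound on the coefficients the graph of the operator associated with the form
is equal to its adjoint. -/
theorem formGraph_adjoint_eq (hp : ContinuousOn p (Ici 0)) (hp0 : ∀ t, 0 ≤ t → 0 ≤ p t)
    (hb : ContinuousOn (fun t => c * deriv (movingAverage x) t) (Ici 0))
    (hr : ContinuousOn (fun t => c * (x t - movingAverage x t)) (Ici 0)) {K : ℝ}
    (hK : ∀ t, 0 ≤ t → |c * deriv (movingAverage x) t| +
      2 * (c * (x t - movingAverage x t)) ^ 2 ≤ p t / 2 + K) :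
    (formGraph p c x hp hp0).adjoint = formGraph p c x hp hp0 := by
  have hpw : ∀ t ∈ Ici (0 : ℝ), 1 + p t ≠ 0 := fun t ht => by
    have := hp0 t ht; positivity
  have hsw : ∀ t ∈ Ici (0 : ℝ), √(1 + p t) ≠ 0 := fun t ht => (sqrt_weight_pos hp0 ht).ne'
  have hsc : ContinuousOn (fun t => √(1 + p t)) (Ici 0) :=
    Real.continuous_sqrt.comp_continuousOn (continuousOn_const.add hp)
  -- The hypothesis gives `|c a'| ≤ p / 2 + K`, so the numerator is at most `3 p / 2 + |K|`.
  obtain ⟨M₁, hM₁⟩ := exists_mulOperator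
    (m := fun t => (p t + c * deriv (movingAverage x) t) / (1 + p t)) (C := 2 + |K|)
    ((hp.add hb).div (continuousOn_const.add hp) hpw) (fun t ht => by
      have h0 := hp0 t ht
      have h1 := hK t ht
      rw [abs_div, abs_of_pos (by linarith : 0 < 1 + p t), div_le_iff₀ (by linarith)]
      have h2 := abs_add_le (p t) (c * deriv (movingAverage x) t)
      rw [abs_of_nonneg h0] at h2
      have h3 := sq_nonneg (c * (x t - movingAverage x t))
      have h4 := le_abs_self K
      have h5 := mul_nonneg (abs_nonneg K) h0
      linarith)
  -- After squaring, `2 r² ≤ p / 2 + K` bounds `r²` by `(1 + |K|)² (1 + p)`.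
  obtain ⟨M₂, hM₂⟩ := exists_mulOperator
    (m := fun t => c * (x t - movingAverage x t) / √(1 + p t)) (C := 1 + |K|)
    (hr.div hsc hsw) (fun t ht => by
      have h0 := hp0 t ht
      have h1 := hK t ht
      rw [abs_div, abs_of_pos (sqrt_weight_pos hp0 ht), div_le_iff₀ (sqrt_weight_pos hp0 ht)]
      refine abs_le_of_sq_le_sq ?_ (by positivity)
      rw [mul_pow _ √(1 + p t), Real.sq_sqrt (by linarith)]
      have h3 := abs_nonneg (c * deriv (movingAverage x) t)
      have h4 := le_abs_self K
      nlinarith [mul_nonneg (abs_nonneg K) h0, mul_nonneg (sq_nonneg |K|) h0, sq_nonneg |K|])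
  -- Dividing by the weight recovers `f` from `√(1 + p) f`, so the map `J` below is the inclusion of
  -- the form domain in `L²`.
  obtain ⟨N, hN⟩ := exists_mulOperator (m := fun t => 1 / √(1 + p t)) (C := 1)
    (continuousOn_const.div hsc hsw) (fun t ht => by
      have h0 := hp0 t ht
      rw [abs_of_nonneg (by positivity), div_le_iff₀ (sqrt_weight_pos hp0 ht), one_mul]
      exact Real.one_le_sqrt.2 (by linarith))
  let V := formSpace p hp hp0
  have : CompleteSpace V := (isClosed_formSpace hp hp0).completeSpace_coe
  obtain ⟨S, hSin⟩ := exists_blockOperator M₁ M₂ V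
  let J : V →L[ℂ] L2 := N ∘L WithLp.sndL 2 ℂ L2 L2 ∘L V.subtypeL
  have hJ : ∀ (w : V) (f : ℝ → ℂ), w.1.snd =ᵐ[halfLine] (fun t => (√(1 + p t) : ℂ) * f t) →
      J w =ᵐ[halfLine] f := by
    intro w f hwf
    have h1 : J w =ᵐ[halfLine] _ := hN w.1.snd
    filter_upwards [h1, hwf, ae_restrict_mem measurableSet_Ioi] with t a b d
    have hs' : (√(1 + p t) : ℂ) ≠ 0 := by exact_mod_cast hsw t (mem_Ici.2 (le_of_lt d))
    rw [a, b]
    push_cast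
    field_simp
  -- The constants `1 / 2` and `K + 1 / 2` are those of `form_pointwise_bound`, integrated over the
  -- half-line.
  refine adjoint_graph_eq_of_coercive J S (δ := 1 / 2) (K := K + 1 / 2) ?_ (by norm_num) ?_ ?_
  · intro w z
    rw [hSin, ← inner_conj_symm w (S z), hSin]
    simp only [map_add, map_sub, inner_conj_symm]
    rw [inner_mulOperator hM₁, inner_mulOperator hM₂, inner_mulOperator hM₂]
    ring
  · intro w
    obtain ⟨f, hf, h1, h2⟩ := w.2
    obtain ⟨i1, i2, e⟩ := airyForm_eq_inner hp0 hM₁ hM₂ hf.1 hf.1 h1 h2 h1 h2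
    obtain ⟨j1, k1⟩ := integrable_inner_and_eq h1 h1
    obtain ⟨j2, k2⟩ := integrable_inner_and_eq h2 h2
    obtain ⟨j3, k3⟩ := integrable_inner_and_eq (hJ w f h2) (hJ w f h2)
    have nsq : ∀ y : L2, ‖y‖ ^ 2 = (inner ℂ y y).re := fun y =>
      (inner_self_eq_norm_sq (𝕜 := ℂ) y).symm
    have hw : ‖w‖ ^ 2 = ‖w.1.fst‖ ^ 2 + ‖w.1.snd‖ ^ 2 := WithLp.prod_norm_sq_eq_of_L2 w.1
    have re_int : ∀ {h : ℝ → ℂ}, Integrable h halfLine →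
        (∫ t, h t ∂halfLine).re = ∫ t, (h t).re ∂halfLine := fun hh => (integral_re hh).symm
    have q : Integrable (fun t => (formIntegrand₁ p c x f f t).re -
        (formIntegrand₂ c x f f t).re) halfLine := i1.re.sub i2.re
    have r1 : Integrable (fun t => (deriv f t * conj (deriv f t)).re) halfLine := j1.re
    have r2 : Integrable (fun t => ((√(1 + p t) : ℂ) * f t *
      conj ((√(1 + p t) : ℂ) * f t)).re) halfLine := j2.re
    have r3 : Integrable (fun t => (f t * conj (f t)).re) halfLine := j3.re
    have q1 : Integrable (fun t => (formIntegrand₁ p c x f f t).re) halfLine := i1.re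
    have q2 : Integrable (fun t => (formIntegrand₂ c x f f t).re) halfLine := i2.re
    rw [hSin, ← e, airyForm, hw, nsq, nsq, nsq (J w), k1, k2, k3, Complex.sub_re, re_int j1,
      re_int j2, re_int j3, re_int i1, re_int i2, ← integral_add r1 r2, ← integral_sub q1 q2,
      ← integral_const_mul, ← integral_const_mul,
      ← integral_add q (r3.const_mul _)]
    refine integral_mono_ae ((r1.add r2).const_mul _) (q.add (r3.const_mul _)) ?_
    filter_upwards [ae_restrict_mem measurableSet_Ioi, hf.1.ae_differentiableAt] with t ht hd
    have key := form_pointwise_bound (hK t (le_of_lt ht)) (deriv f t) (f t)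
    have hmc : ∀ z : ℂ, (z * conj z).re = ‖z‖ ^ 2 := fun z => by
      rw [Complex.mul_conj, Complex.ofReal_re, Complex.normSq_eq_norm_sq]
    have hsym : (f t * conj (deriv f t)).re = (deriv f t * conj (f t)).re := by
      simp only [Complex.mul_re, Complex.conj_re, Complex.conj_im]
      ring
    simp only [hmc, sqrt_weight_sq hp0 ht, formIntegrand₁, formIntegrand₂, Complex.add_re, Complex.re_ofReal_mul, deriv_mul_conj hd hd, hsym]
    linarith
  · intro y
    constructor
    · rintro ⟨ψ, hψ, hy, hi⟩
      obtain ⟨w, hw, h1, h2⟩ := exists_mem_formSpace hp hp0 hψ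
      refine ⟨⟨w, hw⟩, Lp.ext (hy.trans (hJ ⟨w, hw⟩ ψ h2).symm), fun z => ?_⟩
      obtain ⟨u, hu, h3, h4⟩ := z.2
      obtain ⟨-, -, e⟩ := airyForm_eq_inner hp0 hM₁ hM₂ hu.1 hψ.1 h1 h2 h3 h4
      rw [hSin, ← e, (hi u hu).2.2,
        (integrable_inner_and_eq (EventuallyEq.refl _ _) (hJ z u h4)).2]
    · rintro ⟨w, hy, hw⟩
      obtain ⟨ψ, hψ, h1, h2⟩ := w.2
      refine ⟨ψ, hψ, hy ▸ hJ w ψ h2, fun u hu => ?_⟩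
      obtain ⟨z, hz, h3, h4⟩ := exists_mem_formSpace hp hp0 hu
      obtain ⟨i1, i2, e⟩ := airyForm_eq_inner hp0 hM₁ hM₂ hu.1 hψ.1 h1 h2 h3 h4
      refine ⟨i1, i2, ?_⟩
      rw [e, ← hSin w ⟨z, hz⟩, hw,
        (integrable_inner_and_eq (EventuallyEq.refl _ _) (hJ ⟨z, hz⟩ u h4)).2]

end FormOperator

/-! ### Growth of the coefficients -/

section Growth

variable {p : ℝ → ℝ} {c : ℝ} {x : ℝ → ℝ}

theorem hasDerivAt_movingAverage (hx : Continuous x) (t : ℝ) :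
    HasDerivAt (movingAverage x) (x (t + 1) - x t) t := by
  have h0 : ∀ s, HasDerivAt (fun s => ∫ y in (0 : ℝ)..s, x y) (x s) s := fun s =>
    intervalIntegral.integral_hasDerivAt_right (hx.intervalIntegrable _ _)
      (hx.stronglyMeasurableAtFilter _ _) hx.continuousAt
  have h1 : HasDerivAt (fun s => ∫ y in (0 : ℝ)..(s + 1), x y) (x (t + 1)) t :=
    (h0 (t + 1)).comp_add_const t 1
  refine (h1.sub (h0 t)).congr_of_eventuallyEq (Eventually.of_forall fun s => ?_)
  exact (intervalIntegral.integral_interval_sub_left (hx.intervalIntegrable _ _)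
    (hx.intervalIntegrable _ _)).symm

theorem deriv_movingAverage (hx : Continuous x) :
    deriv (movingAverage x) = fun t => x (t + 1) - x t :=
  funext fun t => (hasDerivAt_movingAverage hx t).deriv

theorem contDiff_movingAverage (hx : Continuous x) : ContDiff ℝ 1 (movingAverage x) := by
  rw [contDiff_one_iff_deriv, deriv_movingAverage hx]
  exact ⟨fun t => (hasDerivAt_movingAverage hx t).differentiableAt,
    (hx.comp (continuous_id.add continuous_const)).sub hx⟩

/-- The coefficients of logarithmic growth are small relative to `p`. -/
theorem exists_coefficient_bound (hp0 : ∀ t, 0 ≤ t → 0 ≤ p t)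
    (hgrowth : ∃ α : ℝ, 0 < α ∧ 0 < liminf (fun t : ℝ => ((p t / t ^ α : ℝ) : EReal)) atTop)
    (hx : Continuous x) (hlog : HasLogGrowth x) (c : ℝ) :
    ∃ K : ℝ, ∀ t, 0 ≤ t → |c * deriv (movingAverage x) t| +
      2 * (c * (x t - movingAverage x t)) ^ 2 ≤ p t / 2 + K := by
  obtain ⟨α, hα, hlim⟩ := hgrowth
  -- The lower limit may be infinite; any real `δ` strictly between `0` and it will do.
  obtain ⟨δ, hδ, hδlim⟩ := EReal.lt_iff_exists_real_btwn.1 hlim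
  have hδ0 : 0 < δ := by exact_mod_cast hδ
  have hsq : ∀ f : ℝ → ℝ, f =O[atTop] (fun t => √(Real.log t)) →
      (fun t => f t ^ 2) =o[atTop] fun t : ℝ => t ^ α := by
    intro f hf
    refine IsBigO.trans_isLittleO ?_ (isLittleO_log_rpow_atTop hα)
    refine (hf.pow 2).trans (EventuallyEq.isBigO ?_)
    filter_upwards [eventually_ge_atTop 1] with t ht
    exact Real.sq_sqrt (Real.log_nonneg ht)
  have h1 := hsq _ (hlog.1.const_mul_left c)
  have h2 := hsq _ (hlog.2.const_mul_left c)
  -- With the constant `δ / 2`, the sum of squares is eventually at most `(δ / 2) t ^ α`, hence at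
  -- most `p t / 2`.
  have h3 := (h1.add (h2.const_mul_left 2)).bound (half_pos hδ0)
  have h4 : ∀ᶠ t in atTop, δ < p t / t ^ α := by
    filter_upwards [eventually_lt_of_lt_liminf hδlim] with t ht
    exact_mod_cast ht
  obtain ⟨T, hT⟩ := eventually_atTop.1 ((h3.and h4).and (eventually_gt_atTop 0))
  set B : ℝ → ℝ := fun t => |c * deriv (movingAverage x) t| +
      2 * (c * (x t - movingAverage x t)) ^ 2 with hB
  have hBc : Continuous B := by
    have ha := (contDiff_movingAverage hx).continuous
    have ha' := (contDiff_movingAverage hx).continuous_deriv le_rfl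
    fun_prop
  obtain ⟨C, hC⟩ := (isCompact_Icc (a := (0 : ℝ)) (b := T)).exists_bound_of_continuousOn
    hBc.continuousOn
  -- `C` serves on the compact interval `[0, T]`; beyond it, the `1` pays for `|y| ≤ y² + 1`, which
  -- replaces `|c a'|` by its square.
  refine ⟨max C 1, fun t ht => ?_⟩
  change B t ≤ _
  rcases le_total t T with h | h
  · have := (le_abs_self _).trans (hC t ⟨ht, h⟩)
    linarith [le_max_left C 1, hp0 t ht]
  · obtain ⟨⟨a, b⟩, h0⟩ := hT t h
    have hpos : 0 < t ^ α := Real.rpow_pos_of_pos h0 α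
    rw [lt_div_iff₀ hpos] at b
    rw [Real.norm_of_nonneg hpos.le, Real.norm_of_nonneg (by positivity)] at a
    have e : |c * deriv (movingAverage x) t| ≤ (c * deriv (movingAverage x) t) ^ 2 + 1 := by
      rw [← sq_abs (c * deriv (movingAverage x) t)]
      nlinarith [sq_nonneg (|c * deriv (movingAverage x) t| - 1),
        abs_nonneg (c * deriv (movingAverage x) t)]
    simp only [hB]
    linarith [le_max_right C 1]

end Growth

/-! ### The operator associated with the form is a restriction of the maximal operator -/

section FormLeMax

variable {p : ℝ → ℝ} {c : ℝ} {x : ℝ → ℝ}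

theorem memLp_indicator_of_continuousOn {k : ℝ → ℂ} {T : ℝ} (hk : ContinuousOn k (Icc 0 T)) :
    MemLp ((Ioc 0 T).indicator k) 2 halfLine := by
  rw [memLp_indicator_iff_restrict measurableSet_Ioc,
    Measure.restrict_restrict measurableSet_Ioc, inter_eq_left.2 Ioc_subset_Ioi_self]
  obtain ⟨C, hC⟩ := isCompact_Icc.exists_bound_of_continuousOn hk
  refine MemLp.of_bound ((hk.mono Ioc_subset_Icc_self).aestronglyMeasurable measurableSet_Ioc) C ?_
  filter_upwards [ae_restrict_mem measurableSet_Ioc] with t ht using hC t (Ioc_subset_Icc_self ht)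

theorem integral_halfLine_eq_intervalIntegral {h : ℝ → ℂ} {T : ℝ} (hT : 0 ≤ T)
    (h0 : ∀ᵐ t ∂halfLine, T < t → h t = 0) :
    ∫ t, h t ∂halfLine = ∫ t in (0 : ℝ)..T, h t := by
  rw [intervalIntegral.integral_of_le hT]
  refine setIntegral_eq_of_subset_of_ae_sdiff_eq_zero measurableSet_Ioi.nullMeasurableSet
    Ioc_subset_Ioi_self ?_
  filter_upwards [(ae_restrict_iff' measurableSet_Ioi).1 h0] with t ht hm
  exact ht hm.1 (not_le.1 fun h => hm.2 ⟨hm.1, h⟩)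

/-- A square integrable function on `(0, T)` orthogonal to the derivatives of the functions of the
form domain supported in `[0, T]` is constant. -/
theorem ae_eq_const_of_orthogonal_deriv (hp : ContinuousOn p (Ici 0))
    (hp0 : ∀ t, 0 ≤ t → 0 ≤ p t) {G : ℝ → ℂ} {T : ℝ} (hT : 0 < T)
    (hG : MemLp ((Ioc 0 T).indicator G) 2 halfLine)
    (h : ∀ u ∈ formDomain p, (∀ t, T ≤ t → u t = 0) →
      ∫ t in (0 : ℝ)..T, deriv u t * conj (G t) = 0) :
    ∃ α : ℂ, ∀ᵐ t ∂volume.restrict (Ioc 0 T), G t = α := by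
  have hae : ∀ {f g : ℝ → ℂ}, f =ᵐ[halfLine] g → f =ᵐ[volume.restrict (Ioc 0 T)] g :=
    fun hfg => ae_mono (Measure.restrict_mono Ioc_subset_Ioi_self le_rfl) hfg
  have hGT : MemLp G 2 (volume.restrict (Ioc 0 T)) := by
    rw [memLp_indicator_iff_restrict measurableSet_Ioc,
      Measure.restrict_restrict measurableSet_Ioc, inter_eq_left.2 Ioc_subset_Ioi_self] at hG
    exact hG
  have hGi : IntervalIntegrable G volume 0 T := by
    rw [intervalIntegrable_iff, uIoc_of_le hT.le]
    exact hGT.integrable (by norm_num)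
  -- `α` is the mean of `G`, so the primitive `u` of `G - α`, cut off after `T`, vanishes from `T`
  -- on and is an admissible test function.
  set α : ℂ := (T : ℂ)⁻¹ * ∫ t in (0 : ℝ)..T, G t with hα
  set g : ℝ → ℂ := (Ioc 0 T).indicator fun t => G t - α with hg
  have hgm : MemLp g 2 halfLine := by
    have : g = (Ioc 0 T).indicator G - (Ioc 0 T).indicator fun _ => α := indicator_sub' _ _ _
    rw [this]
    exact hG.sub (memLp_indicator_of_continuousOn continuousOn_const)
  have hgi : ∀ t, 0 ≤ t → IntervalIntegrable g volume 0 t :=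
    fun t ht => intervalIntegrable_of_memLp hgm ht
  set u : ℝ → ℂ := fun t => ∫ s in (0 : ℝ)..t, g s with hu
  have hgG : ∀ᵐ t ∂volume.restrict (Ioc 0 T), g t = G t - α := by
    filter_upwards [ae_restrict_mem measurableSet_Ioc] with t ht
    rw [hg, indicator_of_mem ht]
  have huT : ∫ t in (0 : ℝ)..T, g t = 0 := by
    have e : ∫ t in (0 : ℝ)..T, g t = ∫ t in (0 : ℝ)..T, (G t - α) := by
      refine intervalIntegral.integral_congr_ae_restrict ?_
      rw [uIoc_of_le hT.le]
      exact hgG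
    have hT' : (T : ℂ) ≠ 0 := by exact_mod_cast hT.ne'
    rw [e, intervalIntegral.integral_sub hGi intervalIntegrable_const,
      intervalIntegral.integral_const, sub_zero, Complex.real_smul, hα, mul_inv_cancel_left₀ hT',
      sub_self]
  have hu0 : ∀ t, T ≤ t → u t = 0 := by
    intro t ht
    have h1 : ∫ s in T..t, g s = 0 := by
      refine intervalIntegral.integral_zero_ae (Eventually.of_forall fun s hs => ?_)
      rw [uIoc_of_le ht] at hs
      exact indicator_of_notMem (fun hm => absurd hm.2 (not_le.2 hs.1)) _
    have := intervalIntegral.integral_add_adjacent_intervals (hgi T hT.le)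
      ((hgi T hT.le).symm.trans (hgi t (hT.le.trans ht)))
    rw [hu]
    simp only
    rw [← this, h1, huT, add_zero]
  have huc : ContinuousOn (fun t => (√(1 + p t) : ℂ) * u t) (Icc 0 T) := by
    refine ContinuousOn.mul ?_ ?_
    · exact Complex.continuous_ofReal.comp_continuousOn (Real.continuous_sqrt.comp_continuousOn
        (continuousOn_const.add (hp.mono Icc_subset_Ici_self)))
    · exact (isACHalfLine_primitive hgi).continuousOn.mono Icc_subset_Ici_self
  obtain ⟨hud, hdu⟩ := primitive_mem_formDomain hp0 hgm (memLp_indicator_of_continuousOn huc) (by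
    filter_upwards [ae_restrict_mem measurableSet_Ioi] with t ht
    rcases le_or_gt t T with h1 | h1
    · rw [indicator_of_mem (show t ∈ Ioc 0 T from ⟨ht, h1⟩)]
    · rw [indicator_of_notMem (fun hm => absurd hm.2 (not_le.2 h1))]
      have := hu0 t h1.le
      rw [hu] at this
      simp only at this
      rw [this, mul_zero])
  have hgT : MemLp g 2 (volume.restrict (Ioc 0 T)) :=
    hgm.mono_measure (Measure.restrict_mono Ioc_subset_Ioi_self le_rfl)
  -- `∫ |g|²` is `∫ g Ḡ` minus `ᾱ ∫ g`: the first vanishes by the hypothesis for `u`, the second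
  -- because `g` has mean zero.
  have hzero : ∫ t in Ioc 0 T, g t * conj (g t) = 0 := by
    have h1 := h u hud hu0
    rw [intervalIntegral.integral_of_le hT.le] at h1 huT
    have i1 : Integrable (fun t => g t * conj (G t)) (volume.restrict (Ioc 0 T)) :=
      hgT.integrable_mul hGT.star
    have i2 : Integrable (fun t => g t * conj α) (volume.restrict (Ioc 0 T)) :=
      (hgT.integrable (by norm_num)).mul_const _
    have e1 : ∫ t in Ioc 0 T, g t * conj (G t) = 0 := by
      rw [← h1]
      refine integral_congr_ae ?_
      filter_upwards [hae hdu] with t ht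
      rw [ht]
    calc ∫ t in Ioc 0 T, g t * conj (g t)
        = ∫ t in Ioc 0 T, (g t * conj (G t) - g t * conj α) := by
          refine integral_congr_ae ?_
          filter_upwards [hgG] with t ht
          rw [ht, map_sub]
          ring
      _ = 0 := by rw [integral_sub i1 i2, e1, integral_mul_const, huT, zero_mul, sub_zero]
  refine ⟨α, ?_⟩
  have hn : ∫ t in Ioc 0 T, ‖g t‖ ^ 2 = 0 := by
    have : ∀ t, g t * conj (g t) = ((‖g t‖ ^ 2 : ℝ) : ℂ) := fun t => by
      rw [Complex.mul_conj, Complex.normSq_eq_norm_sq]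
    simp only [this] at hzero
    have e : ∫ t in Ioc 0 T, ((‖g t‖ ^ 2 : ℝ) : ℂ) = ((∫ t in Ioc 0 T, ‖g t‖ ^ 2 : ℝ) : ℂ) :=
      integral_ofReal
    exact_mod_cast e.symm.trans hzero
  rw [integral_eq_zero_iff_of_nonneg (fun t => sq_nonneg ‖g t‖)
    ((memLp_two_iff_integrable_sq_norm hgT.1).1 hgT)] at hn
  filter_upwards [hn, hgG] with t h1 h2
  have h3 : g t = 0 := by simpa using h1
  rw [h3] at h2
  exact (sub_eq_zero.1 h2.symm)

/-- A function that is almost everywhere constant on each `(0, n]` is almost everywhere constant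
on the half-line. -/
theorem ae_eq_const_of_forall_Ioc {G : ℝ → ℂ}
    (h : ∀ T : ℝ, 0 < T → ∃ α : ℂ, ∀ᵐ t ∂volume.restrict (Ioc 0 T), G t = α) :
    ∃ α : ℂ, ∀ᵐ t ∂halfLine, G t = α := by
  obtain ⟨α, hα⟩ := h 1 one_pos
  refine ⟨α, ?_⟩
  have hT : ∀ n : ℕ, ∀ᵐ t, t ∈ Ioc (0 : ℝ) (n + 1) → G t = α := by
    intro n
    have hn : (0 : ℝ) < n + 1 := by positivity
    obtain ⟨β, hβ⟩ := h (n + 1) hn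
    have h1 : ∀ᵐ t ∂volume.restrict (Ioc (0 : ℝ) 1), G t = β :=
      ae_mono (Measure.restrict_mono (Ioc_subset_Ioc_right (by linarith)) le_rfl) hβ
    -- `(0, 1]` has positive measure, so two constants equal to `G` almost everywhere on it must
    -- coincide.
    have : (ae (volume.restrict (Ioc (0 : ℝ) 1))).NeBot := by
      rw [ae_restrict_neBot]
      simp
    obtain ⟨t, ha, hb⟩ := (hα.and h1).exists
    rw [← ae_restrict_iff' measurableSet_Ioc, ← ha, hb]
    exact hβ
  refine (ae_restrict_iff' measurableSet_Ioi).2 ?_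
  filter_upwards [ae_all_iff.2 hT] with t ht h0
  obtain ⟨n, hn⟩ := exists_nat_ge t
  exact ht n ⟨h0, by linarith⟩

/-- Integration by parts in the form, for functions of compact support. -/
theorem integral_deriv_mul_conj_eq_zero (hp : ContinuousOn p (Ici 0)) (hx : Continuous x)
    {ψ φ u : ℝ → ℂ} (hψ : IsACHalfLine ψ) (hφ : MemLp φ 2 halfLine) (hu : u ∈ formDomain p)
    (h1 : Integrable (formIntegrand₁ p c x u ψ) halfLine)
    (h2 : Integrable (formIntegrand₂ c x u ψ) halfLine)
    (h3 : Integrable (fun t => u t * conj (φ t)) halfLine)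
    (he : airyForm p c x u ψ = ∫ t, u t * conj (φ t) ∂halfLine) {T : ℝ} (hT : 0 < T)
    (huT : ∀ t, T ≤ t → u t = 0) :
    ∫ t in (0 : ℝ)..T, deriv u t * conj (quasiDeriv (fun t => c * x t) ψ t -
      ∫ y in (0 : ℝ)..t, (p y * ψ y - (c * x y : ℝ) * deriv ψ y - φ y)) = 0 := by
  have hQ : ContinuousOn (fun t => c * x t) (Ici 0) := (continuous_const.mul hx).continuousOn
  have hφl : LocallyIntegrableOn φ (Ici (0 : ℝ)) volume :=
    locInt_of_intervalIntegrable fun T hT => intervalIntegrable_of_memLp hφ hT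
  have hfi := fun T (hT : 0 ≤ T) => slIntegrand_intervalIntegrable hp hQ hψ hφl hT
  set f : ℝ → ℂ := fun y => p y * ψ y - (c * x y : ℝ) * deriv ψ y - φ y with hf
  set F : ℝ → ℂ := fun t => ∫ y in (0 : ℝ)..t, f y with hF
  have hFac : IsACHalfLine F := isACHalfLine_primitive hfi
  have hFd := ae_deriv_primitive hfi
  have haac : IsACHalfLine (fun t => (movingAverage x t : ℂ)) :=
    isACHalfLine_ofReal fun T _ =>
      (contDiff_movingAverage hx).contDiffOn.absolutelyContinuousOnInterval
  -- The boundary term `w = u F̄ + c a u ψ̄`, zero at `0` and at `T`. Its first part moves the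
  -- derivative onto `u`; its second exchanges `a'` and `x - a` for `x` alone, producing the
  -- quasi-derivative for `Q = c x`.
  set w : ℝ → ℂ := (fun t => u t * conj (F t)) +
    (c : ℂ) • fun t => (movingAverage x t : ℂ) * (u t * conj (ψ t)) with hw
  have hwac : IsACHalfLine w :=
    (hu.1.mul hFac.conj).add ((haac.mul (hu.1.mul hψ.conj)).const_smul _)
  set I : ℝ → ℂ := fun t => formIntegrand₁ p c x u ψ t - formIntegrand₂ c x u ψ t -
    u t * conj (φ t) with hI
  have hIint : Integrable I halfLine := (h1.sub h2).sub h3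
  -- This is the form equation: the integrand vanishes after `T`, where `u` does.
  have hI0 : ∫ t in (0 : ℝ)..T, I t = 0 := by
    rw [← integral_halfLine_eq_intervalIntegral hT.le]
    · have h12 : Integrable (fun t => formIntegrand₁ p c x u ψ t - formIntegrand₂ c x u ψ t)
          halfLine := h1.sub h2
      simp only [hI]
      rw [integral_sub h12 h3, integral_sub h1 h2, ← he, airyForm, sub_self]
    · refine Eventually.of_forall fun t ht => ?_
      have hev : u =ᶠ[𝓝 t] fun _ => (0 : ℂ) := by
        filter_upwards [Ioi_mem_nhds ht] with s hs using huT s (le_of_lt hs)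
      have hev' : (fun s => u s * conj (ψ s)) =ᶠ[𝓝 t] fun _ => (0 : ℂ) := by
        filter_upwards [hev] with s hs
        rw [hs, zero_mul]
      simp [hI, formIntegrand₁, formIntegrand₂, hev.deriv_eq, hev'.deriv_eq, huT t ht.le]
  have hwd : deriv w =ᵐ[halfLine] fun t => I t - deriv u t *
      conj (quasiDeriv (fun t => c * x t) ψ t - F t) := by
    filter_upwards [hu.1.ae_hasDerivAt, hψ.ae_hasDerivAt, hFd] with t du dψ dF
    have da := (hasDerivAt_movingAverage hx t).ofReal_comp
    have dw := (du.mul dF.star).add ((da.mul (du.mul dψ.star)).const_smul (c : ℂ))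
    have e := dw.deriv
    have e' : deriv w t = _ := e
    rw [e']
    simp only [hI, formIntegrand₁, formIntegrand₂,
      deriv_mul_conj du.differentiableAt dψ.differentiableAt, deriv_movingAverage hx, hf, hF, Pi.mul_apply,
      quasiDeriv, map_sub, map_mul, Complex.conj_ofReal, smul_eq_mul, Complex.star_def]
    push_cast
    ring
  obtain ⟨ii, e⟩ := hwac.integral_eq_of_ae hwd hT.le
  have hIi : IntervalIntegrable I volume 0 T := by
    rw [intervalIntegrable_iff, uIoc_of_le hT.le]
    exact IntegrableOn.mono_set hIint Ioc_subset_Ioi_self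
  have hi2 : IntervalIntegrable (fun t => deriv u t *
      conj (quasiDeriv (fun t => c * x t) ψ t - F t)) volume 0 T := by
    have := hIi.sub ii
    refine this.congr_ae (Eventually.of_forall fun t => ?_)
    simp
  have hw0 : w 0 = 0 := by simp [hw, hu.2.1]
  have hwT : w T = 0 := by simp [hw, huT T le_rfl]
  rw [intervalIntegral.integral_sub hIi hi2, hI0, hw0, hwT] at e
  simpa using e

/-- Du Bois-Reymond argument: integration by parts makes `ψ^[1] - ∫ (p ψ - Q ψ' - φ)` orthogonal to
the derivatives of all test functions supported in `[0, T]`. It is therefore constant, and the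
constant is the `α` of the integrated equation. -/
theorem isSLImage_of_isFormImage (hp : ContinuousOn p (Ici 0)) (hp0 : ∀ t, 0 ≤ t → 0 ≤ p t)
    (hx : Continuous x) {ψ φ : ℝ → ℂ} (hψ : ψ ∈ formDomain p) (hφ : MemLp φ 2 halfLine)
    (h : IsFormImage p c x ψ φ) : IsSLImage p (fun t => c * x t) ψ φ := by
  have hφl : LocallyIntegrableOn φ (Ici (0 : ℝ)) volume :=
    locInt_of_intervalIntegrable fun T hT => intervalIntegrable_of_memLp hφ hT
  have hQ : ContinuousOn (fun t => c * x t) (Ici 0) := (continuous_const.mul hx).continuousOn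
  have hfi := fun T (hT : 0 ≤ T) => slIntegrand_intervalIntegrable hp hQ hψ.1 hφl hT
  obtain ⟨α, hα⟩ := ae_eq_const_of_forall_Ioc (G := fun t => quasiDeriv (fun t => c * x t) ψ t -
      ∫ y in (0 : ℝ)..t, (p y * ψ y - (c * x y : ℝ) * deriv ψ y - φ y)) fun T hT => by
    refine ae_eq_const_of_orthogonal_deriv hp hp0 hT ?_ fun u hu huT => ?_
    -- Square integrability on `(0, T]`: `ψ'` is in `L²`, and the remaining terms are continuous on
    -- `[0, T]`.
    · have h1 := (formDomain_deriv_memLp hp0 hψ).indicator (s := Ioc 0 T) measurableSet_Ioc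
      have hc : ContinuousOn (fun t => (c * x t : ℝ) * ψ t +
          ∫ y in (0 : ℝ)..t, (p y * ψ y - (c * x y : ℝ) * deriv ψ y - φ y)) (Ici 0) :=
        ((Complex.continuous_ofReal.comp_continuousOn hQ).mul hψ.1.continuousOn).add
          (isACHalfLine_primitive hfi).continuousOn
      have h2 := h1.sub (memLp_indicator_of_continuousOn
        (hc.mono (fun s (hs : s ∈ Icc 0 T) => hs.1)))
      rw [← indicator_sub'] at h2
      refine (memLp_congr_ae (Eventually.of_forall fun t => ?_)).2 h2
      refine congrFun (indicator_congr fun s _ => ?_) t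
      simp only [quasiDeriv, Pi.sub_apply]
      ring
    · obtain ⟨i1, i2, e⟩ := h u hu
      exact integral_deriv_mul_conj_eq_zero hp hx hψ.1 hφ hu i1 i2
        (mul_conj_integrable (formDomain_memLp hp0 hu) hφ) e hT huT
  refine ⟨hψ.1, hφl, α, ?_⟩
  filter_upwards [hα] with t ht
  rw [← ht]
  ring

theorem formGraph_le_maxGraph (hp : ContinuousOn p (Ici 0)) (hp0 : ∀ t, 0 ≤ t → 0 ≤ p t)
    (hx : Continuous x) (hQ : ContinuousOn (fun t => c * x t) (Ici 0)) :
    formGraph p c x hp hp0 ≤ maxGraph p (fun t => c * x t) hp hQ := by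
  rintro y ⟨ψ, hψ, hy, hi⟩
  have := isSLImage_of_isFormImage hp hp0 hx hψ (Lp.memLp y.2) hi
  exact ⟨ψ, ⟨hψ.2.1, formDomain_memLp hp0 hψ, y.2, this, Lp.memLp _⟩, hy, this⟩

end FormLeMax

/-! ### The minimal operator is a restriction of the operator associated with the form -/

section MinLeForm

variable {p Q : ℝ → ℝ}

theorem deriv_conj (u : ℝ → ℂ) (t : ℝ) : deriv (fun s => conj (u s)) t = conj (deriv u t) :=
  deriv.star

/-- True because `p` and `Q` are real. It reconciles the bilinear bracket with the sesquilinear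
inner product. -/
theorem IsSLImage.conj {u v : ℝ → ℂ} (h : IsSLImage p Q u v) :
    IsSLImage p Q (fun t => conj (u t)) (fun t => conj (v t)) := by
  refine ⟨h.ac.conj, locInt_of_intervalIntegrable fun T hT => ?_, ?_⟩
  · have := intervalIntegrable_of_locInt h.locInt hT
    rw [intervalIntegrable_iff] at this ⊢
    exact Complex.conjCLE.toContinuousLinearMap.integrable_comp this
  · obtain ⟨α, hα⟩ := h.eqn
    refine ⟨conj α, ?_⟩
    filter_upwards [hα, ae_restrict_mem measurableSet_Ioi] with t ht h0
    have e : quasiDeriv Q (fun t => conj (u t)) t = conj (quasiDeriv Q u t) := by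
      simp only [quasiDeriv, deriv_conj, map_sub, map_mul, Complex.conj_ofReal]
    rw [e, ht, map_add, intervalIntegral.integral_of_le (le_of_lt h0),
      intervalIntegral.integral_of_le (le_of_lt h0), ← integral_conj]
    simp only [deriv_conj, map_sub, map_mul, Complex.conj_ofReal]

theorem maxDomain_conj {u : ℝ → ℂ} (hu : u ∈ maxDomain p Q) :
    (fun t => conj (u t)) ∈ maxDomain p Q := by
  obtain ⟨h0, hm, v, hi, hv⟩ := hu
  exact ⟨by simp [h0], hm.star, _, hi.conj, hv.star⟩

/-- The Lagrange identity. -/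
theorem bracket_eq_integral (hp : ContinuousOn p (Ici 0)) (hQ : ContinuousOn Q (Ici 0))
    {u v f g : ℝ → ℂ} (hu : IsSLImage p Q u f) (hv : IsSLImage p Q v g) (hu0 : u 0 = 0)
    (hv0 : v 0 = 0) {t : ℝ} (ht : 0 < t) :
    bracket Q u v t = ∫ s in (0 : ℝ)..t, (f s * v s - u s * g s) := by
  obtain ⟨α, hα⟩ := hu.hasDerivAt hp hQ
  obtain ⟨β, hβ⟩ := hv.hasDerivAt hp hQ
  have hui := fun T (hT : 0 ≤ T) => slIntegrand_intervalIntegrable hp hQ hu.ac hu.locInt hT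
  have hvi := fun T (hT : 0 ≤ T) => slIntegrand_intervalIntegrable hp hQ hv.ac hv.locInt hT
  have hconst : ∀ a : ℂ, IsACHalfLine fun _ => a := fun a T _ =>
    contDiffOn_const.absolutelyContinuousOnInterval
  -- `U` and `V` are the absolutely continuous versions of the quasi-derivatives. In the derivative
  -- of `u V - U v`, substituting `u' = Q u + U` and `v' = Q v + V` cancels every term with `Q` or
  -- `p`, so `Q` is never differentiated.
  set U : ℝ → ℂ := fun t => α + ∫ y in (0 : ℝ)..t, (p y * u y - Q y * deriv u y - f y) with hU
  set V : ℝ → ℂ := fun t => β + ∫ y in (0 : ℝ)..t, (p y * v y - Q y * deriv v y - g y) with hV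
  have hUac : IsACHalfLine U := (hconst α).add (isACHalfLine_primitive hui)
  have hVac : IsACHalfLine V := (hconst β).add (isACHalfLine_primitive hvi)
  set w : ℝ → ℂ := (fun t => u t * V t) + (-1 : ℂ) • fun t => U t * v t with hw
  have hwac : IsACHalfLine w := (hu.ac.mul hVac).add ((hUac.mul hv.ac).const_smul _)
  have hwd : deriv w =ᵐ[halfLine] fun s => f s * v s - u s * g s := by
    filter_upwards [ae_deriv_primitive hui, ae_deriv_primitive hvi,
      ae_restrict_mem measurableSet_Ioi] with s dU dV hs
    have du := hα s hs
    have dv := hβ s hs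
    have dw := (du.mul (dV.const_add β)).add (((dU.const_add α).mul dv).const_smul (-1 : ℂ))
    have e : deriv w s = _ := dw.deriv
    rw [e, du.deriv, dv.deriv]
    simp only [smul_eq_mul]
    ring
  obtain ⟨-, e⟩ := hwac.integral_eq_of_ae hwd ht.le
  rw [e]
  simp only [bracket, quasiDeriv, (hα t ht).deriv, (hβ t ht).deriv, hw, hU, hV, Pi.add_apply,
    Pi.smul_apply, smul_eq_mul, hu0, hv0]
  ring

/-- The minimal graph is orthogonal to the maximal one. -/
theorem minGraph_le_adjoint_maxGraph (hp : ContinuousOn p (Ici 0)) (hQ : ContinuousOn Q (Ici 0)) :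
    minGraph p Q hp hQ ≤ (maxGraph p Q hp hQ).adjoint := by
  rintro y ⟨ψ, hψ, hy, hi⟩
  rw [Submodule.mem_adjoint_iff]
  rintro a b ⟨w, hw, ha, hb⟩
  obtain ⟨i1, e1⟩ := integrable_inner_and_eq (f := b) (EventuallyEq.refl _ _) hy
  obtain ⟨i2, e2⟩ := integrable_inner_and_eq (g := y.2) ha (EventuallyEq.refl _ _)
  rw [e1, e2, ← integral_sub i1 i2]
  -- The bracket is taken with the conjugate of `w`. By the Lagrange identity its negative at `t` is
  -- the integral over `(0, t]` of the integrand in the adjoint relation.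
  have hlim := hψ.2 _ (maxDomain_conj hw)
  have hint : Tendsto (fun t => ∫ s in (0 : ℝ)..t,
      (ψ s * conj ((b : ℝ → ℂ) s) - (y.2 : ℝ → ℂ) s * conj (w s))) atTop
      (𝓝 (∫ s, (ψ s * conj ((b : ℝ → ℂ) s) - (y.2 : ℝ → ℂ) s * conj (w s)) ∂halfLine)) :=
    intervalIntegral_tendsto_integral_Ioi 0 (i1.sub i2) tendsto_id
  refine tendsto_nhds_unique hint ?_
  have hneg := hlim.neg
  rw [neg_zero] at hneg
  refine hneg.congr' ?_
  filter_upwards [eventually_gt_atTop 0] with t ht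
  rw [bracket_eq_integral hp hQ hi hb.conj hψ.1.1 (maxDomain_conj hw).1 ht,
    ← intervalIntegral.integral_neg]
  simp only [neg_sub]

end MinLeForm

end StochasticAiry

end

/-! ### Self-adjointness and the two inclusions along the sample path -/

theorem proposition2 {Ω : Type*} [MeasurableSpace Ω] (P : Measure Ω) [IsProbabilityMeasure P]
    (h : ℝ) (hh : h ∈ Ioo (0 : ℝ) 1)
    (X : ℝ≥0 → Ω → ℝ) (hX : StochasticAiry.IsFractionalBrownianMotion h X P)
    (p : ℝ → ℝ) (hp : ContinuousOn p (Ici 0)) (hp0 : ∀ t, 0 ≤ t → 0 ≤ p t)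
    (hgrowth : ∃ α : ℝ, 0 < α ∧
      0 < liminf (fun t : ℝ => ((p t / t ^ α : ℝ) : EReal)) atTop)
    (c : ℝ) (ω : Ω) (hω : StochasticAiry.HasLogGrowth (StochasticAiry.path X ω)) :
    IsSelfAdjoint (StochasticAiry.formOperator p c (StochasticAiry.path X ω) hp hp0) ∧
    StochasticAiry.minOperator p (fun t => c * StochasticAiry.path X ω t) hp
        (hX.continuousOn_path c ω) ≤
      StochasticAiry.formOperator p c (StochasticAiry.path X ω) hp hp0 ∧
    StochasticAiry.formOperator p c (StochasticAiry.path X ω) hp hp0 ≤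
      StochasticAiry.maxOperator p (fun t => c * StochasticAiry.path X ω t) hp
        (hX.continuousOn_path c ω) := by
  have hx : Continuous (StochasticAiry.path X ω) :=
    (hX.continuous ω).comp continuous_real_toNNReal
  have hQ := hX.continuousOn_path c ω
  obtain ⟨K, hK⟩ := StochasticAiry.exists_coefficient_bound hp0 hgrowth hx hω c
  have ha := StochasticAiry.contDiff_movingAverage hx
  have hadj := StochasticAiry.formGraph_adjoint_eq hp hp0
    (continuous_const.mul (ha.continuous_deriv le_rfl)).continuousOn
    (continuous_const.mul (hx.sub ha.continuous)).continuousOn hK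
  have hle := StochasticAiry.formGraph_le_maxGraph hp hp0 hx hQ
  refine ⟨StochasticAiry.isSelfAdjoint_toLinearPMap
    (StochasticAiry.formGraph_functional hp hp0) hadj, ?_, ?_⟩
  · refine LinearPMap.le_of_le_graph ?_
    rw [StochasticAiry.minOperator, StochasticAiry.formOperator,
      Submodule.toLinearPMap_graph_eq _ (StochasticAiry.minGraph_functional hp hQ),
      Submodule.toLinearPMap_graph_eq _ (StochasticAiry.formGraph_functional hp hp0), ← hadj]
    -- An element of the minimal graph is orthogonal to the maximal graph, hence to the smaller form
    -- graph; so it lies in the adjoint of the form graph, which is the form graph.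
    intro y hy
    have := StochasticAiry.minGraph_le_adjoint_maxGraph hp hQ hy
    rw [Submodule.mem_adjoint_iff] at this ⊢
    exact fun a b hab => this a b (hle hab)
  · refine LinearPMap.le_of_le_graph ?_
    rw [StochasticAiry.maxOperator, StochasticAiry.formOperator,
      Submodule.toLinearPMap_graph_eq _ (StochasticAiry.maxGraph_functional hp hQ),
      Submodule.toLinearPMap_graph_eq _ (StochasticAiry.formGraph_functional hp hp0)]
    exact hle
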